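/- Let $m\ge 1$, let $M$ be a smooth $(2m+1)$-dimensional manifold with a smooth pseudo-Riemannian metric $g$ and Levi-Civita connection $\nabla$, put $n=2m+1$, and let $\phi$ be a (smooth, real) conformal Killing–Yano tensor on $M$, i.e. a 2-form for which there are a 3-form $\tau$ and a 1-form $K$ with $$\nabla_X\phi=\tfrac13\,X\lrcorner\,\tau+\tfrac1{n-1}\,X^*\wedge K\qquad\text{for all vector fields }X$$ (so that $\tau=d\phi$ and $K=-d^*\phi$). Suppose that at every point the endomorphism $\phi^\sharp$ of the tangent space given by $g(\phi^\sharp X,Y)=\phi(X,Y)$ has $2m$ distinct non-zero complex eigenvalues and a one-dimensional kernel; from now on $K\subset TM$ denotes this kernel. A normal form frame on an open set $U$ consists of smooth complex vector fields $V_0,V_\mu,V^\mu$ ($\mu=1,\dots,m$) on $U$, with dual coframe $e^0,\theta^\mu,\theta_\mu$, such that for some functions $\lambda_\mu$ $$g=e^0\otimes e^0+\sum_\mu(\theta^\mu\otimes\theta_\mu+\theta_\mu\otimes\theta^\mu),\qquad \phi=\sum_\mu\lambda_\mu\,\theta^\mu\wedge\theta_\mu ;$$ thus $V_0$ spans the complexification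 of $K$. A normal form basis at a point is defined in the same way. Suppose that at every point $\tau=d\phi$ satisfies, in normal form bases, for all $\mu,\nu,\kappa$, $$\tau(V_\kappa,V_\mu,V_\nu)=\tau(V^\kappa,V^\mu,V^\nu)=0,\qquad \tau(V_\kappa,V_\mu,V^\nu)=\tau(V^\kappa,V^\mu,V_\nu)=0\ \ (\nu\ne\kappa,\mu),$$ $$\tau(V_\mu,V_\nu,V_0)=\tau(V^\mu,V^\nu,V_0)=\tau(V_\mu,V^\nu,V_0)=0\ \ (\mu\neq\nu).$$ (This holds in particular if $\theta^\mu\wedge\tau(V^\mu,\cdot,\cdot)=0=\theta_\mu\wedge\tau(V_\mu,\cdot,\cdot)$ for each $\mu$, and if $\phi$ is closed.) Then every point of $M$ has a neighbourhood with a normal form frame, and for every normal form frame on an open set $U$ the following holds. The $2^m$ distributions $\mathcal D\subset T_{\mathbb C}U$ spanned by choosing one vector from each of the pairs $(V_\mu,V^\mu)$ are pairwise distinct at every point, and each of them 1. is a smooth complex subbundle of rank $m$ that is (maximal) isotropic in the complexification of $K^\perp$, and is integrable: $[\mathcal D,\mathcal D]\subset\mathcal D$; 2. is an integrable CR structure on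 $U$ whenever $\mathcal D\cap\overline{\mathcal D}=0$ on $U$, and $\mathcal D\cap\overline{\mathcal D}=0$ always holds if $g$ is Riemannian (positive definite), so that in this case all $2^m$ of them are integrable CR structures; 3. is such that $\tilde{\mathcal D}=\mathcal D\oplus\langle V_0\rangle$, obtained by adjoining the kernel direction, is a smooth complex subbundle of rank $m+1$ that is integrable: $[\tilde{\mathcal D},\tilde{\mathcal D}]\subset\tilde{\mathcal D}$. -/

import Mathlib

open scoped Manifold ContDiff TensorProduct Bundle
open Bundle

noncomputable section
namespace CKY

section
variable {n : ℕ} {M : Type*} [TopologicalSpace M] [ChartedSpace (EuclideanSpace ℝ (Fin n)) M]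
  [IsManifold (𝓡 n) ∞ M]

/-- A smooth field of bilinear forms on the tangent spaces of a smooth `n`-manifold `M`. -/
structure Tensor2 (n : ℕ) (M : Type*) [TopologicalSpace M]
    [ChartedSpace (EuclideanSpace ℝ (Fin n)) M] [IsManifold (𝓡 n) ∞ M] where
  form (x : M) : TangentSpace (𝓡 n) x →L[ℝ] TangentSpace (𝓡 n) x →L[ℝ] ℝ
  smooth : ContMDiff (𝓡 n)
    ((𝓡 n).prod 𝓘(ℝ, EuclideanSpace ℝ (Fin n) →L[ℝ] EuclideanSpace ℝ (Fin n) →L[ℝ] ℝ)) ∞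
    (fun x ↦ TotalSpace.mk'
      (EuclideanSpace ℝ (Fin n) →L[ℝ] EuclideanSpace ℝ (Fin n) →L[ℝ] ℝ)
      (E := fun x ↦ TangentSpace (𝓡 n) x →L[ℝ] TangentSpace (𝓡 n) x →L[ℝ] ℝ) x (form x))

/-- A smooth pseudo-Riemannian metric, of arbitrary signature. -/
structure PseudoRiemannianMetric (n : ℕ) (M : Type*) [TopologicalSpace M]
    [ChartedSpace (EuclideanSpace ℝ (Fin n)) M] [IsManifold (𝓡 n) ∞ M] extends Tensor2 n M where
  symm (x : M) (u v : TangentSpace (𝓡 n) x) : form x u v = form x v u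
  nondegenerate (x : M) (u : TangentSpace (𝓡 n) x) : (∀ v, form x u v = 0) → u = 0

/-- The (rough) vector field `X` is differentiable at `x`. -/
abbrev DiffAt (X : Π x : M, TangentSpace (𝓡 n) x) (x : M) : Prop :=
  MDifferentiableAt (𝓡 n) (𝓡 n).tangent (fun y ↦ (⟨y, X y⟩ : TangentBundle (𝓡 n) M)) x

theorem Tensor2.mdiff (g : Tensor2 n M) {X Y : Π x : M, TangentSpace (𝓡 n) x} {x : M}
    (hX : DiffAt X x) (hY : DiffAt Y x) :
    MDifferentiableAt (𝓡 n) 𝓘(ℝ, ℝ) (fun y ↦ g.form y (X y) (Y y)) x := by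
  have h1 := (g.smooth.contMDiffAt (x := x)).mdifferentiableAt (by simp)
  have h2 : MDifferentiableAt (𝓡 n) ((𝓡 n).prod 𝓘(ℝ))
      (fun m ↦ TotalSpace.mk' ℝ (E := Bundle.Trivial M ℝ) m (g.form m (X m) (Y m))) x :=
    MDifferentiableAt.clm_bundle_apply₂ (F₁ := EuclideanSpace ℝ (Fin n))
      (F₂ := EuclideanSpace ℝ (Fin n)) h1 hX hY
  simp only [mdifferentiableAt_totalSpace] at h2
  exact h2.2

namespace PseudoRiemannianMetric

/-- The affine connection `D` is torsion-free and compatible with `g`.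
`D Y x u` is the covariant derivative of the field `Y` at `x` in the direction `u`. -/
def IsLeviCivita (g : PseudoRiemannianMetric n M)
    (D : CovariantDerivative (𝓡 n) (EuclideanSpace ℝ (Fin n))
      (TangentSpace (𝓡 n) : M → Type _)) : Prop :=
  D.torsion = 0 ∧
  ∀ (x : M) (Y Z : Π x : M, TangentSpace (𝓡 n) x) (u : TangentSpace (𝓡 n) x),
    DiffAt Y x → DiffAt Z x →
    mvfderiv (𝓡 n) (fun y ↦ g.form y (Y y) (Z y)) x u =
      g.form x (D Y x u) (Z x) + g.form x (Y x) (D Z x u)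

/-- The right-hand side of the Koszul formula for `2 g(∇_X Y, Z)`. -/
def koszul (g : PseudoRiemannianMetric n M) (X Y Z : Π x : M, TangentSpace (𝓡 n) x) (x : M) : ℝ :=
  mvfderiv (𝓡 n) (fun y ↦ g.form y (Y y) (Z y)) x (X x)
  + mvfderiv (𝓡 n) (fun y ↦ g.form y (X y) (Z y)) x (Y x)
  - mvfderiv (𝓡 n) (fun y ↦ g.form y (X y) (Y y)) x (Z x)
  + g.form x (VectorField.mlieBracket (𝓡 n) X Y x) (Z x)
  - g.form x (VectorField.mlieBracket (𝓡 n) X Z x) (Y x)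
  - g.form x (VectorField.mlieBracket (𝓡 n) Y Z x) (X x)

variable (g : PseudoRiemannianMetric n M) {X X' Y Y' Z Z' : Π x : M, TangentSpace (𝓡 n) x} {x : M}
  {f : M → ℝ}

theorem deriv_smul_left (hf : MDifferentiableAt (𝓡 n) 𝓘(ℝ, ℝ) f x) (hX : DiffAt X x)
    (hY : DiffAt Y x) (u : TangentSpace (𝓡 n) x) :
    mvfderiv (𝓡 n) (fun y ↦ g.form y ((f • X) y) (Y y)) x u =
      f x * mvfderiv (𝓡 n) (fun y ↦ g.form y (X y) (Y y)) x u +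
        g.form x (X x) (Y x) * mvfderiv (𝓡 n) f x u := by
  have := mvfderiv_fun_mul hf (g.mdiff hX hY)
  simpa using congr($this u)

theorem deriv_smul_right (hf : MDifferentiableAt (𝓡 n) 𝓘(ℝ, ℝ) f x) (hX : DiffAt X x)
    (hY : DiffAt Y x) (u : TangentSpace (𝓡 n) x) :
    mvfderiv (𝓡 n) (fun y ↦ g.form y (X y) ((f • Y) y)) x u =
      f x * mvfderiv (𝓡 n) (fun y ↦ g.form y (X y) (Y y)) x u +
        g.form x (X x) (Y x) * mvfderiv (𝓡 n) f x u := by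
  have := mvfderiv_fun_mul hf (g.mdiff hX hY)
  simpa using congr($this u)

theorem deriv_add_left (hX : DiffAt X x) (hX' : DiffAt X' x)
    (hY : DiffAt Y x) (u : TangentSpace (𝓡 n) x) :
    mvfderiv (𝓡 n) (fun y ↦ g.form y ((X + X') y) (Y y)) x u =
      mvfderiv (𝓡 n) (fun y ↦ g.form y (X y) (Y y)) x u +
        mvfderiv (𝓡 n) (fun y ↦ g.form y (X' y) (Y y)) x u := by
  have := mvfderiv_fun_add (g.mdiff hX hY) (g.mdiff hX' hY)
  simpa using congr($this u)

theorem deriv_add_right (hX : DiffAt X x) (hY : DiffAt Y x)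
    (hY' : DiffAt Y' x) (u : TangentSpace (𝓡 n) x) :
    mvfderiv (𝓡 n) (fun y ↦ g.form y (X y) ((Y + Y') y)) x u =
      mvfderiv (𝓡 n) (fun y ↦ g.form y (X y) (Y y)) x u +
        mvfderiv (𝓡 n) (fun y ↦ g.form y (X y) (Y' y)) x u := by
  have := mvfderiv_fun_add (g.mdiff hX hY) (g.mdiff hX hY')
  simpa using congr($this u)

theorem koszul_tensorial_left (hY : DiffAt Y x) (hZ : DiffAt Z x) :
    TensorialAt (𝓡 n) (EuclideanSpace ℝ (Fin n)) (fun X ↦ g.koszul X Y Z x) x where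
  smul {f X} hf hX := by
    simp only [koszul, deriv_smul_left g hf hX hZ, deriv_smul_left g hf hX hY,
      VectorField.mlieBracket_smul_left hf hX]
    simp
    ring
  add {X X'} hX hX' := by
    simp only [koszul, deriv_add_left g hX hX' hZ, deriv_add_left g hX hX' hY,
      VectorField.mlieBracket_add_left hX hX']
    simp
    ring

theorem koszul_tensorial_right (hX : DiffAt X x) (hY : DiffAt Y x) :
    TensorialAt (𝓡 n) (EuclideanSpace ℝ (Fin n)) (fun Z ↦ g.koszul X Y Z x) x where
  smul {f Z} hf hZ := by
    simp only [koszul, deriv_smul_right g hf hX hZ, deriv_smul_right g hf hY hZ,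
      VectorField.mlieBracket_smul_right hf hZ]
    simp [g.symm x (Z x)]
    ring
  add {Z Z'} hZ hZ' := by
    simp only [koszul, deriv_add_right g hX hZ hZ', deriv_add_right g hY hZ hZ',
      VectorField.mlieBracket_add_right hZ hZ']
    simp
    ring

theorem koszul_add (hX : DiffAt X x) (hY : DiffAt Y x) (hY' : DiffAt Y' x) (hZ : DiffAt Z x) :
    g.koszul X (Y + Y') Z x = g.koszul X Y Z x + g.koszul X Y' Z x := by
  simp only [koszul, deriv_add_left g hY hY' hZ, deriv_add_right g hX hY hY',
      VectorField.mlieBracket_add_left hY hY', VectorField.mlieBracket_add_right hY hY']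
  simp
  ring

theorem koszul_smul (hf : MDifferentiableAt (𝓡 n) 𝓘(ℝ, ℝ) f x)
    (hX : DiffAt X x) (hY : DiffAt Y x) (hZ : DiffAt Z x) :
    g.koszul X (f • Y) Z x = f x * g.koszul X Y Z x
      + 2 * mvfderiv (𝓡 n) f x (X x) * g.form x (Y x) (Z x) := by
  simp only [koszul, deriv_smul_left g hf hY hZ, deriv_smul_right g hf hX hY,
      VectorField.mlieBracket_smul_left hf hY, VectorField.mlieBracket_smul_right hf hY]
  simp [g.symm x (Y x) (X x)]
  ring

theorem koszul_sub :
    g.koszul X Y Z x - g.koszul Y X Z x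
      = 2 * g.form x (VectorField.mlieBracket (𝓡 n) X Y x) (Z x) := by
  have h : (fun y ↦ g.form y (X y) (Y y)) = fun y ↦ g.form y (Y y) (X y) := by
    ext y; exact g.symm _ _ _
  simp only [koszul, VectorField.mlieBracket_swap_apply (V := Y) (W := X), h]
  simp
  ring

theorem koszul_add_swap :
    g.koszul X Y Z x + g.koszul X Z Y x
      = 2 * mvfderiv (𝓡 n) (fun y ↦ g.form y (Y y) (Z y)) x (X x) := by
  have h : (fun y ↦ g.form y (Z y) (Y y)) = fun y ↦ g.form y (Y y) (Z y) := by
    ext y; exact g.symm _ _ _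
  simp only [koszul, VectorField.mlieBracket_swap_apply (V := Z) (W := Y), h]
  simp
  ring

instance (x : M) : FiniteDimensional ℝ (TangentSpace (𝓡 n) x) :=
  inferInstanceAs (FiniteDimensional ℝ (EuclideanSpace ℝ (Fin n)))

instance (x : M) : T2Space (TangentSpace (𝓡 n) x) :=
  inferInstanceAs (T2Space (EuclideanSpace ℝ (Fin n)))

/-- The metric at `x` as a bilinear form. -/
def bilin (x : M) : LinearMap.BilinForm ℝ (TangentSpace (𝓡 n) x) :=
  (ContinuousLinearMap.coeLM ℝ).comp (g.form x).toLinearMap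

theorem bilin_nondegenerate (x : M) : (g.bilin x).Nondegenerate := by
  constructor
  · intro u h
    exact g.nondegenerate x u h
  · intro u h
    exact g.nondegenerate x u fun v ↦ by rw [g.symm]; exact h v

/-- The vector `v` with `g(v, ·) = f`. -/
def sharp (x : M) : Module.Dual ℝ (TangentSpace (𝓡 n) x) ≃ₗ[ℝ] TangentSpace (𝓡 n) x :=
  ((g.bilin x).toDual (g.bilin_nondegenerate x)).symm

theorem form_sharp (x : M) (f : Module.Dual ℝ (TangentSpace (𝓡 n) x))
    (w : TangentSpace (𝓡 n) x) : g.form x (g.sharp x f) w = f w :=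
  LinearMap.BilinForm.apply_toDual_symm_apply (hB := g.bilin_nondegenerate x) f w

theorem ext_form {u v : TangentSpace (𝓡 n) x} (h : ∀ w, g.form x u w = g.form x v w) : u = v := by
  rw [← sub_eq_zero]
  exact g.nondegenerate x _ fun w ↦ by simp [h w]

open Classical in
/-- The covariant derivative defined by the Koszul formula. -/
def lcFun (Y : Π x : M, TangentSpace (𝓡 n) x) (x : M) :
    TangentSpace (𝓡 n) x →L[ℝ] TangentSpace (𝓡 n) x :=
  if hY : DiffAt Y x then
    (2⁻¹ : ℝ) • LinearMap.toContinuousLinearMap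
     ((g.sharp x).toLinearMap ∘ₗ (ContinuousLinearMap.coeLM ℝ) ∘ₗ
      (TensorialAt.mkHom₂ (I := 𝓡 n) (F := EuclideanSpace ℝ (Fin n))
        (F' := EuclideanSpace ℝ (Fin n)) (fun X Z ↦ g.koszul X Y Z x) x
        (fun _ hZ ↦ g.koszul_tensorial_left hY hZ)
        (fun _ hX ↦ g.koszul_tensorial_right hX hY)).toLinearMap)
  else 0

theorem lcFun_spec (hX : DiffAt X x) (hY : DiffAt Y x) (hZ : DiffAt Z x) :
    2 * g.form x (g.lcFun Y x (X x)) (Z x) = g.koszul X Y Z x := by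
  rw [lcFun, dif_pos hY]
  simp only [smul_apply, map_smul, smul_eq_mul]
  have := TensorialAt.mkHom₂_apply (I := 𝓡 n) (F := EuclideanSpace ℝ (Fin n))
        (F' := EuclideanSpace ℝ (Fin n)) (Φ := fun X Z ↦ g.koszul X Y Z x) (x := x)
        (fun _ hZ ↦ g.koszul_tensorial_left hY hZ)
        (fun _ hX ↦ g.koszul_tensorial_right hX hY) hX hZ
  rw [← this]
  simp [form_sharp]

theorem diffAt_extend (u : TangentSpace (𝓡 n) x) :
    DiffAt (FiberBundle.extend (EuclideanSpace ℝ (Fin n)) u) x :=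
  FiberBundle.mdifferentiableAt_extend ..

theorem exists_isLeviCivita : ∃ D, g.IsLeviCivita D := by
  have ext (x : M) {A B : TangentSpace (𝓡 n) x →L[ℝ] TangentSpace (𝓡 n) x}
      (h : ∀ X Z : Π x : M, TangentSpace (𝓡 n) x, DiffAt X x → DiffAt Z x →
        2 * g.form x (A (X x)) (Z x) = 2 * g.form x (B (X x)) (Z x)) : A = B := by
    ext1 u
    refine g.ext_form fun w ↦ ?_
    have := h _ _ (diffAt_extend u) (diffAt_extend w)
    simpa using this
  let D : CovariantDerivative (𝓡 n) (EuclideanSpace ℝ (Fin n))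
      (TangentSpace (𝓡 n) : M → Type _) :=
    { toFun := g.lcFun
      isCovariantDerivativeOnUniv :=
        { add := by
            intro σ σ' x hσ hσ' _
            refine ext x fun X Z hX hZ ↦ ?_
            have h3 : DiffAt (σ + σ') x := mdifferentiableAt_add_section hσ hσ'
            rw [g.lcFun_spec hX h3 hZ, g.koszul_add hX hσ hσ' hZ, ← g.lcFun_spec hX hσ hZ,
              ← g.lcFun_spec hX hσ' hZ]
            simp
            ring
          leibniz := by
            intro σ f x hσ hf _
            refine ext x fun X Z hX hZ ↦ ?_
            have h3 : DiffAt (f • σ) x := hf.smul_section hσ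
            rw [g.lcFun_spec hX h3 hZ, g.koszul_smul hf hX hσ hZ, ← g.lcFun_spec hX hσ hZ]
            simp
            ring } }
  refine ⟨D, ?_, ?_⟩
  · rw [D.torsion_eq_zero_iff]
    intro X Y x hX hY
    refine g.ext_form fun w ↦ ?_
    have h1 := g.lcFun_spec hX hY (diffAt_extend w)
    have h2 := g.lcFun_spec hY hX (diffAt_extend w)
    have h3 := g.koszul_sub (X := X) (Y := Y)
      (Z := FiberBundle.extend (EuclideanSpace ℝ (Fin n)) w) (x := x)
    rw [FiberBundle.extend_apply_self] at h1 h2 h3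
    change g.form x (g.lcFun Y x (X x) - g.lcFun X x (Y x)) w = _
    simp only [map_sub, sub_apply]
    linarith
  · intro x Y Z u hY hZ
    have h1 := g.lcFun_spec (diffAt_extend u) hY hZ
    have h2 := g.lcFun_spec (diffAt_extend u) hZ hY
    have h3 := g.koszul_add_swap (X := FiberBundle.extend (EuclideanSpace ℝ (Fin n)) u) (Y := Y)
      (Z := Z) (x := x)
    rw [FiberBundle.extend_apply_self] at h1 h2 h3
    rw [g.symm x (Y x)]
    change _ = g.form x (g.lcFun Y x u) (Z x) + g.form x (g.lcFun Z x u) (Y x)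
    linarith

/-- The Levi-Civita connection of `g`. -/
def leviCivita : CovariantDerivative (𝓡 n) (EuclideanSpace ℝ (Fin n))
    (TangentSpace (𝓡 n) : M → Type _) := g.exists_isLeviCivita.choose

theorem leviCivita_spec : g.IsLeviCivita g.leviCivita := g.exists_isLeviCivita.choose_spec

/-- A Levi-Civita connection satisfies the Koszul formula; hence it is unique on
differentiable fields. -/
theorem IsLeviCivita.koszul_eq {D : CovariantDerivative (𝓡 n) (EuclideanSpace ℝ (Fin n))
    (TangentSpace (𝓡 n) : M → Type _)} (h : g.IsLeviCivita D)
    (hX : DiffAt X x) (hY : DiffAt Y x) (hZ : DiffAt Z x) :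
    2 * g.form x (D Y x (X x)) (Z x) = g.koszul X Y Z x := by
  have ht {X Y : Π x : M, TangentSpace (𝓡 n) x} (hX : DiffAt X x) (hY : DiffAt Y x) :
      D Y x (X x) - D X x (Y x) = VectorField.mlieBracket (𝓡 n) X Y x :=
    (D.torsion_eq_zero_iff).1 h.1 hX hY
  simp only [koszul, h.2 x Y Z (X x) hY hZ, h.2 x X Z (Y x) hX hZ, h.2 x X Y (Z x) hX hY,
    ← ht hX hY, ← ht hX hZ, ← ht hY hZ, map_sub, sub_apply, g.symm x (X x), g.symm x (Y x)]
  ring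

/-- The metric is positive definite. -/
def IsRiemannian (g : PseudoRiemannianMetric n M) : Prop :=
  ∀ (x : M) (u : TangentSpace (𝓡 n) x), u ≠ 0 → 0 < g.form x u u

end PseudoRiemannianMetric

/-- A smooth real differential 2-form. -/
structure TwoForm (n : ℕ) (M : Type*) [TopologicalSpace M]
    [ChartedSpace (EuclideanSpace ℝ (Fin n)) M] [IsManifold (𝓡 n) ∞ M] extends Tensor2 n M where
  alt (x : M) (u : TangentSpace (𝓡 n) x) : form x u u = 0

/-- `(∇_u φ)(Y, Z)` at the point `x`, for the Levi-Civita connection of `g`. -/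
def covDeriv (g : PseudoRiemannianMetric n M) (φ : TwoForm n M) (x : M)
    (u : TangentSpace (𝓡 n) x) (Y Z : Π x : M, TangentSpace (𝓡 n) x) : ℝ :=
  mvfderiv (𝓡 n) (fun y ↦ φ.form y (Y y) (Z y)) x u
    - φ.form x (g.leviCivita Y x u) (Z x) - φ.form x (Y x) (g.leviCivita Z x u)

/-- `φ` is a conformal Killing-Yano tensor (conformal Killing 2-form): for some 3-form `τ` and
some 1-form `K`, `∇_X φ = (1/3) X ⌟ τ + (1/(n-1)) X* ∧ K` for all `X`. -/
def IsConformalKillingYano (g : PseudoRiemannianMetric n M) (φ : TwoForm n M) : Prop :=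
  ∃ (τ : Π x : M, TangentSpace (𝓡 n) x [⋀^Fin 3]→ₗ[ℝ] ℝ)
    (K : Π x : M, Module.Dual ℝ (TangentSpace (𝓡 n) x)),
    ∀ (x : M) (u : TangentSpace (𝓡 n) x) (Y Z : Π x : M, TangentSpace (𝓡 n) x),
      DiffAt Y x → DiffAt Z x →
      covDeriv g φ x u Y Z = 1 / 3 * τ x ![u, Y x, Z x]
        + 1 / ((n : ℝ) - 1) * (g.form x u (Y x) * K x (Z x) - g.form x u (Z x) * K x (Y x))

/-- The exterior derivative `dφ` at `x`, evaluated on tangent vectors by the invariant formula,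
which is independent of the fields that extend these vectors. -/
def TwoForm.extDeriv (φ : TwoForm n M) (x : M) (u v w : TangentSpace (𝓡 n) x) : ℝ :=
  let X : Π y : M, TangentSpace (𝓡 n) y := FiberBundle.extend (EuclideanSpace ℝ (Fin n)) u
  let Y : Π y : M, TangentSpace (𝓡 n) y := FiberBundle.extend (EuclideanSpace ℝ (Fin n)) v
  let Z : Π y : M, TangentSpace (𝓡 n) y := FiberBundle.extend (EuclideanSpace ℝ (Fin n)) w
  mvfderiv (𝓡 n) (fun y ↦ φ.form y (Y y) (Z y)) x u
  - mvfderiv (𝓡 n) (fun y ↦ φ.form y (X y) (Z y)) x v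
  + mvfderiv (𝓡 n) (fun y ↦ φ.form y (X y) (Y y)) x w
  - φ.form x (VectorField.mlieBracket (𝓡 n) X Y x) w
  + φ.form x (VectorField.mlieBracket (𝓡 n) X Z x) v
  - φ.form x (VectorField.mlieBracket (𝓡 n) Y Z x) u

/-- The endomorphism `φ^♯` of `T_x M` obtained from `φ` by raising an index:
`g(φ^♯ u, v) = φ(u, v)`. -/
def raise (g : PseudoRiemannianMetric n M) (φ : TwoForm n M) (x : M) :
    TangentSpace (𝓡 n) x →ₗ[ℝ] TangentSpace (𝓡 n) x :=
  (g.sharp x).toLinearMap ∘ₗ (ContinuousLinearMap.coeLM ℝ) ∘ₗ (φ.form x).toLinearMap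

theorem form_raise (g : PseudoRiemannianMetric n M) (φ : TwoForm n M) (x : M)
    (u v : TangentSpace (𝓡 n) x) : g.form x (raise g φ x u) v = φ.form x u v := by
  simp [raise, g.form_sharp]

/-- On a manifold of dimension `2m + 1`: at `x` the (complex) non-zero eigenvalues of `φ^♯` are
`2m` distinct numbers, and the kernel of `φ^♯` is one-dimensional. -/
def IsGenericAt (m : ℕ) (g : PseudoRiemannianMetric n M) (φ : TwoForm n M) (x : M) : Prop :=
  {c : ℂ | c ≠ 0 ∧ Module.End.HasEigenvalue ((raise g φ x).baseChange ℂ) c}.ncard = 2 * m ∧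
  Module.finrank ℝ (LinearMap.ker (raise g φ x)) = 1

/-! ### The complexified tangent bundle -/

/-- The complexified tangent space at `x`. -/
abbrev CTangent (n : ℕ) {M : Type*} [TopologicalSpace M]
    [ChartedSpace (EuclideanSpace ℝ (Fin n)) M] (x : M) : Type :=
  ℂ ⊗[ℝ] TangentSpace (𝓡 n) x

section Complexification
variable {T : Type*} [AddCommGroup T] [Module ℝ T]

/-- The real part of a complexified vector. -/
def rePart : ℂ ⊗[ℝ] T →ₗ[ℝ] T := (TensorProduct.lid ℝ T).toLinearMap ∘ₗ Complex.reLm.rTensor T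

/-- The imaginary part of a complexified vector. -/
def imPart : ℂ ⊗[ℝ] T →ₗ[ℝ] T := (TensorProduct.lid ℝ T).toLinearMap ∘ₗ Complex.imLm.rTensor T

/-- The vector `a + i b`. -/
def ofParts (a b : T) : ℂ ⊗[ℝ] T := 1 ⊗ₜ[ℝ] a + Complex.I ⊗ₜ[ℝ] b

theorem rePart_ofParts (a b : T) : rePart (ofParts a b) = a := by
  simp [rePart, ofParts]

theorem imPart_ofParts (a b : T) : imPart (ofParts a b) = b := by
  simp [imPart, ofParts]

theorem ofParts_parts (z : ℂ ⊗[ℝ] T) : ofParts (rePart z) (imPart z) = z := by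
  induction z using TensorProduct.induction_on with
  | zero => simp [ofParts]
  | add a b ha hb =>
    rw [map_add, map_add]
    conv_rhs => rw [← ha, ← hb]
    simp only [ofParts, TensorProduct.tmul_add]
    abel
  | tmul c t =>
    simp only [ofParts, rePart, imPart, LinearMap.comp_apply, LinearMap.rTensor_tmul,
      LinearEquiv.coe_coe, TensorProduct.lid_tmul, TensorProduct.tmul_smul,
      TensorProduct.smul_tmul', ← TensorProduct.add_tmul]
    congr 1
    apply Complex.ext <;> simp

/-- Complex conjugation of complexified vectors. -/
def conjVec : ℂ ⊗[ℝ] T →ₗ[ℝ] ℂ ⊗[ℝ] T := Complex.conjAe.toLinearMap.rTensor T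

/-- The complex conjugate of a complex subspace. -/
def conjSubspace (D : Submodule ℂ (ℂ ⊗[ℝ] T)) : Submodule ℂ (ℂ ⊗[ℝ] T) :=
  Submodule.span ℂ (conjVec '' (D : Set (ℂ ⊗[ℝ] T)))

/-- The complex-linear extension of a real-linear function. -/
def cExt (f : T → ℂ) (z : ℂ ⊗[ℝ] T) : ℂ := f (rePart z) + Complex.I * f (imPart z)

/-- The complex-bilinear extension of a real-bilinear form. -/
def cExt₂ (B : T → T → ℝ) (z w : ℂ ⊗[ℝ] T) : ℂ :=
  cExt (fun a ↦ cExt (fun b ↦ (B a b : ℂ)) w) z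

/-- The complex-trilinear extension of a real-trilinear form. -/
def cExt₃ (B : T → T → T → ℝ) (z w t : ℂ ⊗[ℝ] T) : ℂ :=
  cExt (fun a ↦ cExt₂ (B a) w t) z

end Complexification

/-- The complex-bilinear extension of the metric. -/
def gC (g : PseudoRiemannianMetric n M) (x : M) (z w : CTangent n x) : ℂ :=
  cExt₂ (fun a b ↦ g.form x a b) z w

/-- The complex-bilinear extension of the 2-form. -/
def formC (φ : TwoForm n M) (x : M) (z w : CTangent n x) : ℂ :=
  cExt₂ (fun a b ↦ φ.form x a b) z w

/-- The complex-trilinear extension of `dφ`. -/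
def extDerivC (φ : TwoForm n M) (x : M) (z w t : CTangent n x) : ℂ :=
  cExt₃ (φ.extDeriv x) z w t

/-- The complex vector field `V` is smooth on `U`. -/
def SmoothFieldOn (V : Π x : M, CTangent n x) (U : Set M) : Prop :=
  ContMDiffOn (𝓡 n) (𝓡 n).tangent ∞
    (fun x ↦ (⟨x, rePart (V x)⟩ : TangentBundle (𝓡 n) M)) U ∧
  ContMDiffOn (𝓡 n) (𝓡 n).tangent ∞
    (fun x ↦ (⟨x, imPart (V x)⟩ : TangentBundle (𝓡 n) M)) U

/-- The complex-bilinear extension of the Lie bracket of vector fields. -/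
def lieBracketC (V W : Π x : M, CTangent n x) (x : M) : CTangent n x :=
  ofParts
    (VectorField.mlieBracket (𝓡 n) (fun y ↦ rePart (V y)) (fun y ↦ rePart (W y)) x
      - VectorField.mlieBracket (𝓡 n) (fun y ↦ imPart (V y)) (fun y ↦ imPart (W y)) x)
    (VectorField.mlieBracket (𝓡 n) (fun y ↦ rePart (V y)) (fun y ↦ imPart (W y)) x
      + VectorField.mlieBracket (𝓡 n) (fun y ↦ imPart (V y)) (fun y ↦ rePart (W y)) x)

/-- `D` is a smooth complex subbundle of rank `r` of the complexified tangent bundle over `U`. -/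
def IsSubbundleOn (r : ℕ) (D : Π x : M, Submodule ℂ (CTangent n x)) (U : Set M) : Prop :=
  ∀ x ∈ U, ∃ U' ⊆ U, IsOpen U' ∧ x ∈ U' ∧ ∃ e : Fin r → Π x : M, CTangent n x,
    (∀ i, SmoothFieldOn (e i) U') ∧
    ∀ y ∈ U', LinearIndependent ℂ (fun i ↦ e i y) ∧
      Submodule.span ℂ (Set.range fun i ↦ e i y) = D y

/-- Frobenius integrability `[D, D] ⊆ D` over `U`: the bracket of any two smooth local sections
of `D` is a section of `D`. -/
def IsIntegrableOn (D : Π x : M, Submodule ℂ (CTangent n x)) (U : Set M) : Prop :=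
  ∀ U' ⊆ U, IsOpen U' → ∀ V W : Π x : M, CTangent n x,
    SmoothFieldOn V U' → SmoothFieldOn W U' →
    (∀ x ∈ U', V x ∈ D x) → (∀ x ∈ U', W x ∈ D x) → ∀ x ∈ U', lieBracketC V W x ∈ D x

/-- `D` is an (integrable) CR structure over `U`, of complex rank `m`. -/
structure IsCRStructureOn (m : ℕ) (D : Π x : M, Submodule ℂ (CTangent n x)) (U : Set M) :
    Prop where
  subbundle : IsSubbundleOn m D U
  inf_conj : ∀ x ∈ U, D x ⊓ conjSubspace (D x) = ⊥
  integrable : IsIntegrableOn D U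

/-! ### Normal form, and the distributions associated with a 2-form -/

/-- The vectors `v0, v i, w i` (written `V_0, V_μ, V^μ` on paper) of the complexified tangent space
at `x` put `g` and `φ` in normal form. With the dual basis `e⁰, θ^μ, θ_μ`, where
`θ^μ = g(V^μ, ·)` and `θ_μ = g(V_μ, ·)`, these are the relations
`g = e⁰ ⊗ e⁰ + ∑ (θ^μ ⊗ θ_μ + θ_μ ⊗ θ^μ)` and `φ = ∑ λ_μ θ^μ ∧ θ_μ`. -/
structure IsNormalBasisAt {m : ℕ} (g : PseudoRiemannianMetric n M) (φ : TwoForm n M) (x : M)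
    (lam : Fin m → ℂ) (v0 : CTangent n x) (v w : Fin m → CTangent n x) : Prop where
  g_vv (i j : Fin m) : gC g x (v i) (v j) = 0
  g_ww (i j : Fin m) : gC g x (w i) (w j) = 0
  g_vw (i j : Fin m) : gC g x (v i) (w j) = if i = j then 1 else 0
  g_v0 (i : Fin m) : gC g x (v i) v0 = 0
  g_w0 (i : Fin m) : gC g x (w i) v0 = 0
  g_00 : gC g x v0 v0 = 1
  phi_vv (i j : Fin m) : formC φ x (v i) (v j) = 0
  phi_ww (i j : Fin m) : formC φ x (w i) (w j) = 0
  phi_vw (i j : Fin m) : formC φ x (v i) (w j) = if i = j then lam i else 0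
  phi_v0 (i : Fin m) : formC φ x (v i) v0 = 0
  phi_w0 (i : Fin m) : formC φ x (w i) v0 = 0

/-- A smooth normal form frame for `g` and `φ` over `U`, with eigenvalue functions `lam i`. -/
structure IsNormalFrameOn {m : ℕ} (g : PseudoRiemannianMetric n M) (φ : TwoForm n M) (U : Set M)
    (lam : Fin m → M → ℂ) (V0 : Π x : M, CTangent n x)
    (V W : Fin m → Π x : M, CTangent n x) : Prop where
  smooth_V0 : SmoothFieldOn V0 U
  smooth_V (i : Fin m) : SmoothFieldOn (V i) U
  smooth_W (i : Fin m) : SmoothFieldOn (W i) U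
  normal : ∀ x ∈ U, IsNormalBasisAt g φ x (fun i ↦ lam i x) (V0 x) (fun i ↦ V i x) (fun i ↦ W i x)

/-- The condition on `τ = dφ` at `x`, in components with respect to every normal form basis at
`x` (it does not depend on the basis): all components of `τ` vanish except those of the form
`τ(V_μ, V^μ, ·)`. -/
def TauConditionAt (m : ℕ) (g : PseudoRiemannianMetric n M) (φ : TwoForm n M) (x : M) : Prop :=
  ∀ (lam : Fin m → ℂ) (v0 : CTangent n x) (v w : Fin m → CTangent n x),
    IsNormalBasisAt g φ x lam v0 v w →
    (∀ k i j, extDerivC φ x (v k) (v i) (v j) = 0 ∧ extDerivC φ x (w k) (w i) (w j) = 0) ∧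
    (∀ k i j, j ≠ i → j ≠ k →
      extDerivC φ x (v k) (v i) (w j) = 0 ∧ extDerivC φ x (w k) (w i) (v j) = 0) ∧
    (∀ i j, i ≠ j → extDerivC φ x (v i) (v j) v0 = 0 ∧ extDerivC φ x (w i) (w j) v0 = 0 ∧
      extDerivC φ x (v i) (w j) v0 = 0)

theorem gC_symm (g : PseudoRiemannianMetric n M) (x : M) (z w : CTangent n x) :
    gC g x z w = gC g x w z := by
  simp only [gC, cExt₂, cExt, g.symm x (rePart w), g.symm x (imPart w)]
  ring

/-- The condition on `τ` holds if `θ^μ ∧ τ(V^μ, ·, ·) = 0` and `θ_μ ∧ τ(V_μ, ·, ·) = 0`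
for every `μ`, where `θ^μ = g(V^μ, ·)` and `θ_μ = g(V_μ, ·)`. -/
theorem tauConditionAt_of_wedge {m : ℕ} (g : PseudoRiemannianMetric n M) (φ : TwoForm n M) (x : M)
    (h : ∀ (lam : Fin m → ℂ) (v0 : CTangent n x) (v w : Fin m → CTangent n x),
      IsNormalBasisAt g φ x lam v0 v w → ∀ (i : Fin m) (a b c : CTangent n x),
        gC g x (w i) a * extDerivC φ x (w i) b c + gC g x (w i) b * extDerivC φ x (w i) c a
          + gC g x (w i) c * extDerivC φ x (w i) a b = 0 ∧
        gC g x (v i) a * extDerivC φ x (v i) b c + gC g x (v i) b * extDerivC φ x (v i) c a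
          + gC g x (v i) c * extDerivC φ x (v i) a b = 0) :
    TauConditionAt m g φ x := by
  intro lam v0 v w hb
  have hwv (i j : Fin m) : gC g x (w i) (v j) = if j = i then 1 else 0 := by
    rw [gC_symm, hb.g_vw]
  refine ⟨fun k i j ↦ ⟨?_, ?_⟩, fun k i j h1 h2 ↦ ⟨?_, ?_⟩, fun i j h1 ↦ ⟨?_, ?_, ?_⟩⟩
  · simpa [hb.g_vw, hb.g_vv] using (h lam v0 v w hb k (w k) (v i) (v j)).2
  · simpa [hwv, hb.g_ww] using (h lam v0 v w hb k (v k) (w i) (w j)).1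
  · simpa [hb.g_vw, hb.g_vv, h2.symm] using (h lam v0 v w hb k (w k) (v i) (w j)).2
  · simpa [hwv, hb.g_ww, h2] using (h lam v0 v w hb k (v k) (w i) (v j)).1
  · simpa [hb.g_vw, hb.g_vv, hb.g_v0] using (h lam v0 v w hb i (w i) (v j) v0).2
  · simpa [hwv, hb.g_ww, hb.g_w0] using (h lam v0 v w hb i (v i) (w j) v0).1
  · simpa [hb.g_vw, hb.g_v0, h1] using (h lam v0 v w hb i (w i) (w j) v0).2

/-- The distribution spanned by choosing one vector from each of the pairs `(V i, W i)`. -/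
def choiceDist {m : ℕ} (V W : Fin m → Π x : M, CTangent n x) (s : Fin m → Bool) (x : M) :
    Submodule ℂ (CTangent n x) :=
  Submodule.span ℂ (Set.range fun i ↦ if s i then V i x else W i x)

/-- The distribution obtained from `choiceDist` by adjoining `V0`. -/
def choiceDistAdjoin {m : ℕ} (V0 : Π x : M, CTangent n x) (V W : Fin m → Π x : M, CTangent n x)
    (s : Fin m → Bool) (x : M) : Submodule ℂ (CTangent n x) :=
  choiceDist V W s x ⊔ Submodule.span ℂ {V0 x}

/-- `D` is an `m`-dimensional isotropic subspace of the complexification of `K^⊥`, where `K` is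
the kernel of `φ` at `x`. For a one-dimensional non-null `K` in dimension `2m + 1` this means that
`D` is maximal isotropic in `K^⊥`. -/
def IsMaximalIsotropic (m : ℕ) (g : PseudoRiemannianMetric n M) (φ : TwoForm n M) (x : M)
    (D : Submodule ℂ (CTangent n x)) : Prop :=
  Module.finrank ℂ D = m ∧ (∀ z ∈ D, ∀ w ∈ D, gC g x z w = 0) ∧
  ∀ z ∈ D, ∀ k ∈ LinearMap.ker (raise g φ x), gC g x z (1 ⊗ₜ[ℝ] k) = 0

end
end CKY
end

/-!
Exchanging `V μ` with `W μ` and `λ μ` with `-λ μ` for some of the `μ` turns a normal form frame into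
another one, so it suffices to treat the span of the `V μ` and its sum with the line of `V0`. These
are cut out by the equations `g(·, C) = 0`, where `C` runs through the `V μ` and `V0` for the former
and through the `V μ` for the latter. As the Levi-Civita connection is metric and torsion free, such
a distribution is integrable as soon as `g(a, ∇_b C)` is symmetric in `a` and `b`, and here all the
relevant terms except for `a = b = V0` even vanish: let `A` and `B` be orthogonal members of the
frame with `φ^♯`-eigenvalues `c` and `d`. If `a` is orthogonal to both, then differentiating
`g(A, B) = 0` and `φ(A, B) = 0` along `a` gives
`g(∇_a A, B) + g(A, ∇_a B) = 0` and `c g(A, ∇_a B) - d g(∇_a A, B) = -τ(a, A, B) / 3`,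
whence `(c + d) g(∇_a A, B) = τ(a, A, B) / 3`.

A normal form frame exists because the eigenvalues of `φ^♯` are simple: by the implicit function
theorem, applied to `φ(v, ·) - c g(v, ·) = 0`, eigenvectors extend to smooth eigenfields. Since
`φ^♯` is skew-adjoint, `g` pairs only fields with opposite eigenvalues, and it remains to rescale.
-/

noncomputable section

namespace CKY

open LinearMap (BilinForm)
open Module (Basis End finrank)
open Filter Topology

section DualFamily

variable {K V ι : Type*} [Field K] [AddCommGroup V] [Module K V] [DecidableEq ι]
  {B : BilinForm K V} {e e' : ι → V}

theorem linearIndependent_of_dualFamily (h : ∀ a b, B (e a) (e' b) = if a = b then 1 else 0) :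
    LinearIndependent K e :=
  .of_pairwise_dual_eq_zero_one e (fun a ↦ B.flip (e' a))
    (fun a b hab ↦ by simp [h, hab.symm]) fun a ↦ by simp [h]

theorem sum_dualFamily_smul [Fintype ι] [FiniteDimensional K V]
    (h : ∀ a b, B (e a) (e' b) = if a = b then 1 else 0) (hcard : Fintype.card ι = finrank K V)
    (z : V) : ∑ a, B z (e' a) • e a = z := by
  let b := basisOfLinearIndependentOfCardEqFinrank' e (linearIndependent_of_dualFamily h) hcard
  have hsum : ∑ a, (B.flip (e' a)).smulRight (e a) = LinearMap.id :=
    b.ext fun a ↦ by simp [b, h]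
  simpa using congr($hsum z)

end DualFamily

section Bilinear

variable {R V : Type*} [CommRing R] [AddCommGroup V] [Module R V] {B : BilinForm R V}
  {S T : Set V} {y z : V}

theorem apply_eq_zero_of_mem_span (h : ∀ a ∈ S, ∀ b ∈ T, B a b = 0)
    (hy : y ∈ Submodule.span R S) (hz : z ∈ Submodule.span R T) : B y z = 0 := by
  induction hy, hz using Submodule.span_induction₂ with
  | mem_mem a b ha hb => exact h a ha b hb
  | zero_left => simp
  | zero_right => simp
  | add_left => simp [*]
  | add_right => simp [*]
  | smul_left => simp [*]
  | smul_right => simp [*]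

theorem apply_eq_apply_swap_of_mem_span (h : ∀ a ∈ S, ∀ b ∈ S, B a b = B b a)
    (hy : y ∈ Submodule.span R S) (hz : z ∈ Submodule.span R S) : B y z = B z y :=
  sub_eq_zero.1 <| apply_eq_zero_of_mem_span (B := B - B.flip)
    (fun a ha b hb ↦ sub_eq_zero.2 (h a ha b hb)) hy hz

end Bilinear

section Eigenbasis

variable {K V ι : Type*} [Field K] [AddCommGroup V] [Module K V] {f : End K V} {b : Basis ι K V}
  {c : ι → K}

theorem repr_apply_eigenbasis (hb : ∀ a, f (b a) = c a • b a) (z : V) (a : ι) :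
    b.repr (f z) a = c a * b.repr z a := by
  have hcoord : b.coord a ∘ₗ f = c a • b.coord a := b.ext fun a' ↦ by
    obtain rfl | h := eq_or_ne a' a
    · simp [hb]
    · simp [hb, h]
  exact congr($hcoord z)

theorem exists_eq_of_hasEigenvalue (hb : ∀ a, f (b a) = c a • b a) {μ : K}
    (hμ : f.HasEigenvalue μ) : ∃ a, c a = μ := by
  obtain ⟨z, hz⟩ := hμ.exists_hasEigenvector
  obtain ⟨a, ha⟩ : ∃ a, b.repr z a ≠ 0 := by
    by_contra! h
    exact hz.2 (b.repr.map_eq_zero_iff.1 (Finsupp.ext h))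
  refine ⟨a, mul_right_cancel₀ ha ?_⟩
  rw [← repr_apply_eigenbasis hb, hz.apply_eq_smul, map_smul, Finsupp.smul_apply, smul_eq_mul]

theorem eq_zero_and_mem_span_of_sub_smul_eq (hb : ∀ a, f (b a) = c a • b a)
    (hc : Function.Injective c) {a : ι} {μ : K} {y : V} (hy : f y - c a • y = μ • b a) :
    μ = 0 ∧ y ∈ Submodule.span K {b a} := by
  have hrepr (a' : ι) : (c a' - c a) * b.repr y a' = μ * b.repr (b a) a' := by
    have := congr(b.repr $hy a')
    simp only [map_sub, map_smul, Finsupp.sub_apply, Finsupp.smul_apply, smul_eq_mul,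
      repr_apply_eigenbasis hb] at this
    rw [← this, sub_mul]
  have hμ : μ = 0 := by simpa using (hrepr a).symm
  refine ⟨hμ, Submodule.mem_span_singleton.2 ⟨b.repr y a, b.repr.injective ?_⟩⟩
  ext a'
  obtain rfl | h := eq_or_ne a' a
  · simp
  · have := hrepr a'
    rw [hμ, zero_mul, mul_eq_zero, or_iff_right (sub_ne_zero.2 (hc.ne h))] at this
    simp [this, h.symm]

end Eigenbasis

section SkewAdjoint

variable {K V ι : Type*} [Field K] [AddCommGroup V] [Module K V] {B : BilinForm K V} {f : End K V}

theorem add_mul_apply_eq_zero_of_isSkewAdjoint (hf : B.IsSkewAdjoint f) {c d : K} {y z : V}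
    (hy : f y = c • y) (hz : f z = d • z) : (c + d) * B y z = 0 := by
  have := hf y z
  simp only [Pi.neg_apply, hy, hz, map_smul, map_neg, LinearMap.smul_apply,
    smul_eq_mul] at this
  linear_combination this

theorem hasEigenvalue_neg_of_isSkewAdjoint [FiniteDimensional K V] (hB : B.SeparatingLeft)
    (hf : B.IsSkewAdjoint f) {c : K} (hc : f.HasEigenvalue c) : f.HasEigenvalue (-c) := by
  obtain ⟨z, hz⟩ := hc.exists_hasEigenvector
  by_contra hneg
  rw [Module.End.hasEigenvalue_iff, not_not, Module.End.eigenspace_def] at hneg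
  have hsurj := LinearMap.surjective_of_injective (LinearMap.ker_eq_bot.1 hneg)
  refine hz.2 (hB z fun y' ↦ ?_)
  obtain ⟨y, rfl⟩ := hsurj y'
  have := hf z y
  simp only [hz.apply_eq_smul, Pi.neg_apply, map_smul, map_neg, LinearMap.smul_apply,
    smul_eq_mul] at this
  simp only [LinearMap.sub_apply, map_sub, LinearMap.smul_apply, End.one_apply, map_smul,
    smul_eq_mul]
  linear_combination this

variable {b : Basis ι K V} {c : ι → K} {σ : ι → ι}

theorem apply_eq_zero_of_ne_of_isSkewAdjoint (hf : B.IsSkewAdjoint f)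
    (hb : ∀ a, f (b a) = c a • b a) (hc : Function.Injective c) (hσ : ∀ a, c (σ a) = -c a)
    {a a' : ι} (h : a' ≠ σ a) : B (b a) (b a') = 0 := by
  refine (mul_eq_zero.1 (add_mul_apply_eq_zero_of_isSkewAdjoint hf (hb a) (hb a'))).resolve_left
    fun h0 ↦ h (hc ?_)
  rw [hσ, eq_neg_of_add_eq_zero_right h0]

theorem apply_ne_zero_of_isSkewAdjoint (hB : B.SeparatingLeft) (hf : B.IsSkewAdjoint f)
    (hb : ∀ a, f (b a) = c a • b a) (hc : Function.Injective c) (hσ : ∀ a, c (σ a) = -c a)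
    (a : ι) : B (b a) (b (σ a)) ≠ 0 := by
  intro h
  have hzero : B (b a) = 0 := b.ext fun a' ↦ by
    obtain rfl | h' := eq_or_ne a' (σ a)
    · exact h
    · exact apply_eq_zero_of_ne_of_isSkewAdjoint hf hb hc hσ h'
  exact b.ne_zero a (hB _ fun z ↦ by simp [hzero])

end SkewAdjoint

section Complexification

variable {T : Type*} [AddCommGroup T] [Module ℝ T]

theorem rePart_tmul (c : ℂ) (t : T) : rePart (c ⊗ₜ[ℝ] t) = c.re • t := by
  simp [rePart]

theorem imPart_tmul (c : ℂ) (t : T) : imPart (c ⊗ₜ[ℝ] t) = c.im • t := by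
  simp [imPart]

theorem rePart_smul (c : ℂ) (z : ℂ ⊗[ℝ] T) :
    rePart (c • z) = c.re • rePart z - c.im • imPart z := by
  induction z using TensorProduct.induction_on with
  | zero => simp
  | add a b ha hb => rw [smul_add, map_add, ha, hb, map_add, map_add]; module
  | tmul d t =>
    simp only [TensorProduct.smul_tmul', rePart_tmul, imPart_tmul, smul_eq_mul,
      Complex.mul_re]
    module

theorem imPart_smul (c : ℂ) (z : ℂ ⊗[ℝ] T) :
    imPart (c • z) = c.re • imPart z + c.im • rePart z := by
  induction z using TensorProduct.induction_on with
  | zero => simp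
  | add a b ha hb => rw [smul_add, map_add, ha, hb, map_add, map_add]; module
  | tmul d t =>
    simp only [TensorProduct.smul_tmul', rePart_tmul, imPart_tmul, smul_eq_mul,
      Complex.mul_im]
    module

theorem ext_parts {z w : ℂ ⊗[ℝ] T} (hr : rePart z = rePart w) (hi : imPart z = imPart w) :
    z = w := by
  rw [← ofParts_parts z, ← ofParts_parts w, hr, hi]

theorem rePart_conjVec (z : ℂ ⊗[ℝ] T) : rePart (conjVec z) = rePart z := by
  induction z using TensorProduct.induction_on with
  | zero => simp
  | add a b ha hb => simp only [map_add, ha, hb]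
  | tmul d t => simp [conjVec, rePart_tmul]

theorem imPart_conjVec (z : ℂ ⊗[ℝ] T) : imPart (conjVec z) = -imPart z := by
  induction z using TensorProduct.induction_on with
  | zero => simp
  | add a b ha hb => simp only [map_add, ha, hb, neg_add]
  | tmul d t => simp [conjVec, imPart_tmul]

theorem conjVec_smul (c : ℂ) (z : ℂ ⊗[ℝ] T) :
    conjVec (c • z) = starRingEnd ℂ c • conjVec z := by
  induction z using TensorProduct.induction_on with
  | zero => simp
  | add a b ha hb => simp only [smul_add, map_add, ha, hb]
  | tmul d t => simp [TensorProduct.smul_tmul', conjVec]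

theorem conjVec_conjVec (z : ℂ ⊗[ℝ] T) : conjVec (conjVec z) = z := by
  apply ext_parts <;> simp [rePart_conjVec, imPart_conjVec]

theorem conjVec_mem_of_mem_conjSubspace {D : Submodule ℂ (ℂ ⊗[ℝ] T)} {z : ℂ ⊗[ℝ] T}
    (hz : z ∈ conjSubspace D) : conjVec z ∈ D := by
  induction hz using Submodule.span_induction with
  | mem _ h => obtain ⟨y, hy, rfl⟩ := h; rwa [conjVec_conjVec]
  | zero => simp
  | add y z _ _ hy hz => rw [map_add]; exact D.add_mem hy hz
  | smul c z _ hz => rw [conjVec_smul]; exact D.smul_mem _ hz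

theorem cExt₂_eq_baseChange (B : BilinForm ℝ T) (z w : ℂ ⊗[ℝ] T) :
    cExt₂ (fun a b ↦ B a b) z w = B.baseChange ℂ z w := by
  conv_rhs => rw [← ofParts_parts z, ← ofParts_parts w]
  simp only [cExt₂, cExt, ofParts, map_add, LinearMap.add_apply, BilinForm.baseChange_tmul,
    Complex.real_smul]
  ring

theorem baseChange_apply_one_tmul (B : BilinForm ℝ T) (z : ℂ ⊗[ℝ] T) (t : T) :
    B.baseChange ℂ z (1 ⊗ₜ t) = B (rePart z) t + Complex.I * B (imPart z) t := by
  simp [← cExt₂_eq_baseChange, cExt₂, cExt, rePart_tmul, imPart_tmul]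

theorem separatingLeft_baseChange {B : BilinForm ℝ T} (hB : B.SeparatingLeft) :
    (B.baseChange ℂ).SeparatingLeft := by
  intro z hz
  have hparts (t : T) : B (rePart z) t = 0 ∧ B (imPart z) t = 0 := by
    have := hz (1 ⊗ₜ t)
    rw [baseChange_apply_one_tmul] at this
    exact ⟨by simpa using congr(($this).re), by simpa using congr(($this).im)⟩
  exact ext_parts (by simpa using hB _ fun t ↦ (hparts t).1)
    (by simpa using hB _ fun t ↦ (hparts t).2)

theorem baseChange_apply_conjVec {B : BilinForm ℝ T} (hB : B.IsSymm) (z : ℂ ⊗[ℝ] T) :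
    B.baseChange ℂ z (conjVec z) =
      (B (rePart z) (rePart z) + B (imPart z) (imPart z) : ℝ) := by
  simp only [← cExt₂_eq_baseChange, cExt₂, cExt, rePart_conjVec, imPart_conjVec, map_neg,
    hB.eq (imPart z) (rePart z)]
  push_cast
  linear_combination -(B (imPart z) (imPart z) : ℂ) * Complex.I_sq

theorem cExt₃_swap₁₂ {B : T → T → T → ℝ} (h : ∀ a b c, B b a c = -B a b c) (z w t : ℂ ⊗[ℝ] T) :
    cExt₃ B w z t = -cExt₃ B z w t := by
  simp only [cExt₃, cExt₂, cExt, h (rePart z) (rePart w), h (imPart z) (rePart w),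
    h (rePart z) (imPart w), h (imPart z) (imPart w)]
  push_cast
  ring

theorem cExt₃_swap₂₃ {B : T → T → T → ℝ} (h : ∀ a b c, B a c b = -B a b c) (z w t : ℂ ⊗[ℝ] T) :
    cExt₃ B z t w = -cExt₃ B z w t := by
  simp only [cExt₃, cExt₂, cExt, h _ (rePart w) (rePart t), h _ (imPart w) (rePart t),
    h _ (rePart w) (imPart t), h _ (imPart w) (imPart t)]
  push_cast
  ring

end Complexification

section Tensors

variable {n : ℕ} {M : Type*} [TopologicalSpace M] [ChartedSpace (EuclideanSpace ℝ (Fin n)) M]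

instance (x : M) : FiniteDimensional ℂ (CTangent n x) :=
  inferInstanceAs (FiniteDimensional ℂ (ℂ ⊗[ℝ] EuclideanSpace ℝ (Fin n)))

theorem finrank_cTangent (x : M) : finrank ℂ (CTangent n x) = n :=
  Module.finrank_baseChange.trans finrank_euclideanSpace_fin

variable [IsManifold (𝓡 n) ∞ M]

/-- The complex-bilinear extension of a tensor field to the complexified tangent space at `x`.
Unlike `gC` and `formC` it is bundled as a bilinear form. -/
def Tensor2.complexForm (t : Tensor2 n M) (x : M) : BilinForm ℂ (CTangent n x) :=
  BilinForm.baseChange ℂ ((ContinuousLinearMap.coeLM ℝ).comp (t.form x).toLinearMap)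

theorem Tensor2.complexForm_apply (t : Tensor2 n M) (x : M) (z w : CTangent n x) :
    t.complexForm x z w = cExt₂ (fun a b ↦ t.form x a b) z w :=
  (cExt₂_eq_baseChange _ z w).symm

theorem gC_eq_complexForm (g : PseudoRiemannianMetric n M) (x : M) (z w : CTangent n x) :
    gC g x z w = g.complexForm x z w :=
  (g.complexForm_apply x z w).symm

theorem formC_eq_complexForm (φ : TwoForm n M) (x : M) (z w : CTangent n x) :
    formC φ x z w = φ.complexForm x z w :=
  (φ.complexForm_apply x z w).symm

theorem PseudoRiemannianMetric.complexForm_comm (g : PseudoRiemannianMetric n M) (x : M)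
    (z w : CTangent n x) : g.complexForm x z w = g.complexForm x w z := by
  simpa only [gC_eq_complexForm] using gC_symm g x z w

theorem PseudoRiemannianMetric.separatingLeft_complexForm (g : PseudoRiemannianMetric n M) (x : M) :
    (g.complexForm x).SeparatingLeft :=
  separatingLeft_baseChange (g.nondegenerate x)

theorem TwoForm.form_swap (φ : TwoForm n M) (x : M) (a b : TangentSpace (𝓡 n) x) :
    φ.form x b a = -φ.form x a b := by
  have := φ.alt x (a + b)
  simp only [map_add, add_apply, φ.alt] at this
  linarith

theorem TwoForm.complexForm_swap (φ : TwoForm n M) (x : M) (z w : CTangent n x) :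
    φ.complexForm x w z = -φ.complexForm x z w := by
  simp only [Tensor2.complexForm_apply, cExt₂, cExt, φ.form_swap x (rePart z),
    φ.form_swap x (imPart z)]
  push_cast
  ring

/-- The complex-linear extension of the endomorphism `φ^♯`. -/
def complexRaise (g : PseudoRiemannianMetric n M) (φ : TwoForm n M) (x : M) :
    End ℂ (CTangent n x) :=
  (raise g φ x).baseChange ℂ

variable (g : PseudoRiemannianMetric n M) (φ : TwoForm n M) {x : M}

theorem complexForm_complexRaise (z w : CTangent n x) :
    g.complexForm x (complexRaise g φ x z) w = φ.complexForm x z w := by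
  induction z using TensorProduct.induction_on with
  | zero => simp
  | add z z' hz hz' => simp only [map_add, LinearMap.add_apply, hz, hz']
  | tmul c a =>
    induction w using TensorProduct.induction_on with
    | zero => simp
    | add w w' hw hw' => simp only [map_add, hw, hw']
    | tmul d b =>
      rw [complexRaise, LinearMap.baseChange_tmul, Tensor2.complexForm, Tensor2.complexForm,
        BilinForm.baseChange_tmul, BilinForm.baseChange_tmul]
      congr 1
      exact form_raise g φ x a b

theorem complexRaise_one_tmul (a : TangentSpace (𝓡 n) x) :
    complexRaise g φ x (1 ⊗ₜ a) = 1 ⊗ₜ raise g φ x a :=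
  LinearMap.baseChange_tmul _ _ _

theorem isSkewAdjoint_complexRaise : (g.complexForm x).IsSkewAdjoint (complexRaise g φ x) := by
  intro z w
  rw [complexForm_complexRaise, Pi.neg_apply, map_neg, g.complexForm_comm,
    complexForm_complexRaise, φ.complexForm_swap]

theorem complexRaise_eq_smul_iff {c : ℂ} {z : CTangent n x} : complexRaise g φ x z = c • z ↔
    ∀ w, φ.complexForm x z w = c * g.complexForm x z w := by
  simp only [← complexForm_complexRaise g φ]
  refine ⟨fun h w ↦ by simp [h], fun h ↦ sub_eq_zero.1 (g.separatingLeft_complexForm x _ ?_)⟩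
  simp [h]

end Tensors

section NormalBasis

/-- The index set `{0} ∪ {μ} ∪ {μ}` of a normal form basis `v0, v μ, w μ`. -/
abbrev NormalIndex (m : ℕ) : Type := Option (Fin m ⊕ Fin m)

/-- The involution of `NormalIndex m` exchanging the indices of `v μ` and `w μ`. -/
def NormalIndex.swap {m : ℕ} : NormalIndex m → NormalIndex m
  | none => none
  | some (.inl i) => some (.inr i)
  | some (.inr i) => some (.inl i)

theorem NormalIndex.swap_involutive {m : ℕ} :
    Function.Involutive (NormalIndex.swap : NormalIndex m → NormalIndex m) := by
  rintro (_ | _ | _) <;> rfl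

theorem card_normalIndex (m : ℕ) : Fintype.card (NormalIndex m) = 2 * m + 1 := by
  simp [two_mul]

/-- The family `v0, v μ, w μ` indexed by `NormalIndex m`. -/
def normalFamily {m : ℕ} {α : Type*} (v0 : α) (v w : Fin m → α) : NormalIndex m → α
  | none => v0
  | some (.inl i) => v i
  | some (.inr i) => w i

variable {n m : ℕ} {M : Type*} [TopologicalSpace M] [ChartedSpace (EuclideanSpace ℝ (Fin n)) M]
  [IsManifold (𝓡 n) ∞ M] {g : PseudoRiemannianMetric n M} {φ : TwoForm n M} {x : M}
  {lam : Fin m → ℂ} {v0 : CTangent n x} {v w : Fin m → CTangent n x}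

theorem isNormalBasisAt_iff : IsNormalBasisAt g φ x lam v0 v w ↔ ∀ a b,
    g.complexForm x (normalFamily v0 v w a) (normalFamily v0 v w b) =
      (if b = a.swap then 1 else 0) ∧
    φ.complexForm x (normalFamily v0 v w a) (normalFamily v0 v w b) =
      if b = a.swap then normalFamily 0 lam (-lam) a else 0 := by
  have hφ (a b) : formC φ x b a = -formC φ x a b := by
    simp only [formC_eq_complexForm, φ.complexForm_swap x a b]
  simp only [← gC_eq_complexForm, ← formC_eq_complexForm]
  refine ⟨fun h ↦ ?_, fun h ↦ ?_⟩
  · have g_0v (i : Fin m) := (gC_symm g x v0 (v i)).trans (h.g_v0 i)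
    have g_0w (i : Fin m) := (gC_symm g x v0 (w i)).trans (h.g_w0 i)
    have g_wv (i j : Fin m) := (gC_symm g x (w i) (v j)).trans (h.g_vw j i)
    have phi_00 := self_eq_neg.1 (hφ v0 v0)
    rintro (_ | i | i) (_ | j | j)
    all_goals simp only [normalFamily, NormalIndex.swap, Pi.neg_apply]
    all_goals grind [h.g_vv, h.g_ww, h.g_vw, h.g_v0, h.g_w0, h.g_00, h.phi_vv, h.phi_ww,
      h.phi_vw, h.phi_v0, h.phi_w0]
  · simp only [Option.forall, Sum.forall, normalFamily, NormalIndex.swap] at h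
    constructor <;> grind

theorem IsNormalBasisAt.flip (h : IsNormalBasisAt g φ x lam v0 v w) (s : Fin m → Bool) :
    IsNormalBasisAt g φ x (fun i ↦ if s i then lam i else -lam i) v0
      (fun i ↦ if s i then v i else w i) (fun i ↦ if s i then w i else v i) := by
  have g_wv (i j : Fin m) : gC g x (w i) (v j) = if i = j then 1 else 0 := by
    rw [gC_symm, h.g_vw]; simp only [eq_comm]
  have phi_wv (i j : Fin m) : formC φ x (w i) (v j) = if i = j then -lam i else 0 := by
    rw [formC_eq_complexForm, φ.complexForm_swap, ← formC_eq_complexForm, h.phi_vw]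
    grind
  constructor <;> intros
  all_goals try split_ifs
  all_goals grind [h.g_vv, h.g_ww, h.g_vw, h.g_v0, h.g_w0, h.g_00, h.phi_vv, h.phi_ww,
    h.phi_vw, h.phi_v0, h.phi_w0]

end NormalBasis

section OddDimension

variable {m : ℕ} {M : Type*} [TopologicalSpace M]
  [ChartedSpace (EuclideanSpace ℝ (Fin (2 * m + 1))) M] [IsManifold (𝓡 (2 * m + 1)) ∞ M]
  {g : PseudoRiemannianMetric (2 * m + 1) M} {φ : TwoForm (2 * m + 1) M} {x : M}
  {lam : Fin m → ℂ} {v0 : CTangent (2 * m + 1) x} {v w : Fin m → CTangent (2 * m + 1) x}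

namespace IsNormalBasisAt

theorem complexForm_normalFamily_swap (h : IsNormalBasisAt g φ x lam v0 v w)
    (a b : NormalIndex m) :
    g.complexForm x (normalFamily v0 v w a) (normalFamily v0 v w b.swap) =
      if a = b then 1 else 0 := by
  rw [(isNormalBasisAt_iff.1 h a b.swap).1]
  exact if_congr (by rw [NormalIndex.swap_involutive.injective.eq_iff, eq_comm]) rfl rfl

theorem exists_basis (h : IsNormalBasisAt g φ x lam v0 v w) :
    ∃ b : Basis (NormalIndex m) ℂ (CTangent (2 * m + 1) x), ⇑b = normalFamily v0 v w :=
  ⟨basisOfLinearIndependentOfCardEqFinrank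
      (linearIndependent_of_dualFamily h.complexForm_normalFamily_swap)
      ((card_normalIndex m).trans (finrank_cTangent x).symm),
    coe_basisOfLinearIndependentOfCardEqFinrank _ _⟩

theorem sum_smul_eq (h : IsNormalBasisAt g φ x lam v0 v w) (z : CTangent (2 * m + 1) x) :
    g.complexForm x z v0 • v0 + (∑ i, g.complexForm x z (w i) • v i +
      ∑ i, g.complexForm x z (v i) • w i) = z := by
  simpa [normalFamily, NormalIndex.swap] using sum_dualFamily_smul h.complexForm_normalFamily_swap
    ((card_normalIndex m).trans (finrank_cTangent x).symm) z

theorem complexRaise_normalFamily (h : IsNormalBasisAt g φ x lam v0 v w) (a : NormalIndex m) :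
    complexRaise g φ x (normalFamily v0 v w a) =
      normalFamily 0 lam (-lam) a • normalFamily v0 v w a := by
  obtain ⟨b, hb⟩ := h.exists_basis
  rw [complexRaise_eq_smul_iff]
  suffices φ.complexForm x (normalFamily v0 v w a) =
      normalFamily 0 lam (-lam) a • g.complexForm x (normalFamily v0 v w a) from
    fun z ↦ congr($this z)
  refine b.ext fun a' ↦ ?_
  obtain ⟨hg, hφ⟩ := isNormalBasisAt_iff.1 h a a'
  simp [hb, hg, hφ]

theorem mem_span_range_iff (h : IsNormalBasisAt g φ x lam v0 v w) {z : CTangent (2 * m + 1) x} :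
    z ∈ Submodule.span ℂ (Set.range v) ↔
      g.complexForm x z v0 = 0 ∧ ∀ i, g.complexForm x z (v i) = 0 := by
  have hg := h.g_v0
  have hvv := h.g_vv
  simp only [gC_eq_complexForm] at hg hvv
  refine ⟨fun hz ↦ ⟨?_, fun i ↦ ?_⟩, fun ⟨h0, hv⟩ ↦ ?_⟩
  · exact apply_eq_zero_of_mem_span (by simpa using hg) hz (Submodule.mem_span_singleton_self v0)
  · exact apply_eq_zero_of_mem_span (by simpa using fun j ↦ hvv j i) hz
      (Submodule.mem_span_singleton_self (v i))
  · rw [← h.sum_smul_eq z]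
    simpa [h0, hv] using Submodule.sum_mem _ fun i _ ↦
      Submodule.smul_mem _ _ (Submodule.subset_span (Set.mem_range_self i))

theorem mem_span_range_sup_iff (h : IsNormalBasisAt g φ x lam v0 v w)
    {z : CTangent (2 * m + 1) x} :
    z ∈ Submodule.span ℂ (Set.range v) ⊔ Submodule.span ℂ {v0} ↔
      ∀ i, g.complexForm x z (v i) = 0 := by
  refine ⟨fun hz i ↦ ?_, fun hv ↦ ?_⟩
  · obtain ⟨y, hy, _, hc, rfl⟩ := Submodule.mem_sup.1 hz
    obtain ⟨c, rfl⟩ := Submodule.mem_span_singleton.1 hc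
    have h0 := h.g_v0 i
    rw [gC_symm, gC_eq_complexForm] at h0
    simp [(h.mem_span_range_iff.1 hy).2 i, h0]
  · rw [← h.sum_smul_eq z]
    simp only [hv, zero_smul, Finset.sum_const_zero, add_zero]
    exact Submodule.add_mem _
      (Submodule.mem_sup_right (Submodule.smul_mem _ _ (Submodule.mem_span_singleton_self v0)))
      (Submodule.mem_sup_left (Submodule.sum_mem _ fun i _ ↦
        Submodule.smul_mem _ _ (Submodule.subset_span (Set.mem_range_self i))))

theorem linearIndependent (h : IsNormalBasisAt g φ x lam v0 v w) : LinearIndependent ℂ v :=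
  (linearIndependent_of_dualFamily h.complexForm_normalFamily_swap).comp
    (fun i ↦ some (.inl i)) fun i j hij ↦ by simpa using hij

theorem linearIndependent_finCons (h : IsNormalBasisAt g φ x lam v0 v w) :
    LinearIndependent ℂ (Fin.cons v0 v : Fin (m + 1) → CTangent (2 * m + 1) x) := by
  have hcons : Fin.cons v0 v = normalFamily v0 v w ∘ Fin.cons none fun i ↦ some (.inl i) := by
    ext i
    cases i using Fin.cases <;> rfl
  rw [hcons]
  refine (linearIndependent_of_dualFamily h.complexForm_normalFamily_swap).comp _ ?_
  exact Fin.cons_injective_iff.2 ⟨by simp, fun i j hij ↦ by simpa using hij⟩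

theorem apply_eq_zero_of_mem_span_range (h : IsNormalBasisAt g φ x lam v0 v w)
    {y z : CTangent (2 * m + 1) x} (hy : y ∈ Submodule.span ℂ (Set.range v))
    (hz : z ∈ Submodule.span ℂ (Set.range v)) : g.complexForm x y z = 0 :=
  apply_eq_zero_of_mem_span (by simpa [gC_eq_complexForm] using h.g_vv) hy hz

theorem eigenvalue_add_ne_zero (h : IsNormalBasisAt g φ x lam v0 v w) (hgen : IsGenericAt m g φ x)
    (i j : Fin m) : lam i + lam j ≠ 0 := by
  classical
  obtain ⟨b, hb⟩ := h.exists_basis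
  have hsub : {c : ℂ | c ≠ 0 ∧ (complexRaise g φ x).HasEigenvalue c} ⊆
      (Finset.univ.image (Sum.elim lam (-lam)) : Finset ℂ) := fun c ⟨hc0, hc⟩ ↦ by
    obtain ⟨_ | a, rfl⟩ := exists_eq_of_hasEigenvalue
      (b := b) (fun a ↦ hb ▸ h.complexRaise_normalFamily a) hc
    · exact absurd rfl hc0
    · exact Finset.mem_coe.2 (Finset.mem_image.2 ⟨a, Finset.mem_univ a, by cases a <;> rfl⟩)
  have hcard := Set.ncard_le_ncard hsub (Finset.finite_toSet _)
  rw [complexRaise, hgen.1, Set.ncard_coe_finset] at hcard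
  have hinj : Function.Injective (Sum.elim lam (-lam)) := by
    rw [← Set.injOn_univ, ← Finset.coe_univ, ← Finset.card_image_iff]
    exact Finset.card_image_le.antisymm (by simpa [two_mul] using hcard)
  intro hij
  exact Sum.inl_ne_inr (hinj (show Sum.elim lam (-lam) (.inl i) = Sum.elim lam (-lam) (.inr j) from
    eq_neg_of_add_eq_zero_left hij))

theorem isMaximalIsotropic (h : IsNormalBasisAt g φ x lam v0 v w)
    (hgen : IsGenericAt m g φ x) :
    IsMaximalIsotropic m g φ x (Submodule.span ℂ (Set.range v)) := by
  refine ⟨by rw [finrank_span_eq_card h.linearIndependent, Fintype.card_fin], fun y hy z hz ↦ ?_,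
    fun z hz k hk ↦ ?_⟩
  · rw [gC_eq_complexForm, h.apply_eq_zero_of_mem_span_range hy hz]
  · have hk : complexRaise g φ x (1 ⊗ₜ k) = (0 : ℂ) • (1 ⊗ₜ k) := by
      rw [complexRaise_one_tmul, LinearMap.mem_ker.1 hk]
      simp
    have hv (i : Fin m) : g.complexForm x (v i) (1 ⊗ₜ k) = 0 := by
      have := add_mul_apply_eq_zero_of_isSkewAdjoint (isSkewAdjoint_complexRaise g φ)
        (h.complexRaise_normalFamily (some (.inl i))) hk
      simpa [normalFamily, add_self_eq_zero.not.1 (h.eigenvalue_add_ne_zero hgen i i)] using this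
    rw [gC_eq_complexForm]
    exact apply_eq_zero_of_mem_span (by simpa using hv) hz (Submodule.mem_span_singleton_self _)

theorem injective_span_choice (h : IsNormalBasisAt g φ x lam v0 v w) :
    Function.Injective fun s : Fin m → Bool ↦
      Submodule.span ℂ (Set.range fun i ↦ if s i then v i else w i) := by
  intro s s' hss
  by_contra hne
  obtain ⟨i, hi⟩ := Function.ne_iff.1 hne
  have hmem : (if s' i then v i else w i) ∈
      Submodule.span ℂ (Set.range fun i ↦ if s i then v i else w i) := by
    rw [show Submodule.span ℂ _ = _ from hss]
    exact Submodule.subset_span ⟨i, rfl⟩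
  have hzero := (h.flip s).apply_eq_zero_of_mem_span_range
    (Submodule.subset_span (Set.mem_range_self i)) hmem
  have hone := (h.flip s).g_vw i i
  rw [gC_eq_complexForm] at hone
  grind

end IsNormalBasisAt

end OddDimension

section Riemannian

variable {n : ℕ} {M : Type*} [TopologicalSpace M] [ChartedSpace (EuclideanSpace ℝ (Fin n)) M]
  [IsManifold (𝓡 n) ∞ M] {g : PseudoRiemannianMetric n M} {x : M}

theorem inf_conjSubspace_eq_bot (hg : g.IsRiemannian) {D : Submodule ℂ (CTangent n x)}
    (hD : ∀ z ∈ D, ∀ w ∈ D, g.complexForm x z w = 0) : D ⊓ conjSubspace D = ⊥ := by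
  refine eq_bot_iff.2 fun z ⟨hz, hz'⟩ ↦ ?_
  have hsum := (baseChange_apply_conjVec ⟨g.symm x⟩ z).symm.trans
    (hD z hz _ (conjVec_mem_of_mem_conjSubspace hz'))
  norm_cast at hsum
  have hnonneg (u : TangentSpace (𝓡 n) x) : 0 ≤ g.form x u u := by
    obtain rfl | hu := eq_or_ne u 0
    · simp
    · exact (hg x u hu).le
  have hzero {u : TangentSpace (𝓡 n) x} (hu : g.form x u u = 0) : u = 0 := by
    by_contra hne
    exact (hg x u hne).ne' hu
  obtain ⟨hre, him⟩ := (add_eq_zero_iff_of_nonneg (hnonneg _) (hnonneg _)).1 hsum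
  exact ext_parts ((hzero hre).trans (map_zero _).symm) ((hzero him).trans (map_zero _).symm)

end Riemannian

section Connection

variable {n : ℕ} {M : Type*} [TopologicalSpace M] [ChartedSpace (EuclideanSpace ℝ (Fin n)) M]

theorem mvfderiv_eq_zero_of_eventuallyEq_const {f : M → ℝ} {x : M} {c : ℝ}
    (h : f =ᶠ[𝓝 x] fun _ ↦ c) : mvfderiv (𝓡 n) f x = 0 := by
  rw [← mvfderiv_const (x := x) (I := 𝓡 n) c]
  ext u
  exact congr(($(h.mfderiv_eq) : EuclideanSpace ℝ (Fin n) →L[ℝ] ℝ) u)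

variable [IsManifold (𝓡 n) ∞ M]

theorem mlieBracket_eq_leviCivita_sub (g : PseudoRiemannianMetric n M)
    {X Y : Π x : M, TangentSpace (𝓡 n) x} {x : M} (hX : DiffAt X x) (hY : DiffAt Y x) :
    VectorField.mlieBracket (𝓡 n) X Y x = g.leviCivita Y x (X x) - g.leviCivita X x (Y x) :=
  (g.leviCivita.torsion_eq_zero_iff.1 g.leviCivita_spec.1 hX hY).symm

/-- The covariant derivative `∇t` of the tensor field `t` at `x`, for the Levi-Civita connection of
`g`, is the trilinear form `q`, where `q u` is the derivative in the direction `u`. -/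
def Tensor2.HasCovDerivAt (t : Tensor2 n M) (g : PseudoRiemannianMetric n M) (x : M)
    (q : TangentSpace (𝓡 n) x → TangentSpace (𝓡 n) x → TangentSpace (𝓡 n) x → ℝ) : Prop :=
  ∀ (u : TangentSpace (𝓡 n) x) (Y Z : Π x : M, TangentSpace (𝓡 n) x), DiffAt Y x → DiffAt Z x →
    mvfderiv (𝓡 n) (fun y ↦ t.form y (Y y) (Z y)) x u = q u (Y x) (Z x) +
      t.form x (g.leviCivita Y x u) (Z x) + t.form x (Y x) (g.leviCivita Z x u)

theorem PseudoRiemannianMetric.hasCovDerivAt_zero (g : PseudoRiemannianMetric n M) (x : M) :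
    g.HasCovDerivAt g x 0 := fun u Y Z hY hZ ↦ by
  simpa using g.leviCivita_spec.2 x Y Z u hY hZ

variable {g : PseudoRiemannianMetric n M} {φ : TwoForm n M} {x : M}

theorem extDeriv_eq_of_hasCovDerivAt
    {q : TangentSpace (𝓡 n) x → TangentSpace (𝓡 n) x → TangentSpace (𝓡 n) x → ℝ}
    (h : φ.HasCovDerivAt g x q) (u v w : TangentSpace (𝓡 n) x) :
    φ.extDeriv x u v w = q u v w - q v u w + q w u v := by
  have hX := PseudoRiemannianMetric.diffAt_extend u
  have hY := PseudoRiemannianMetric.diffAt_extend v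
  have hZ := PseudoRiemannianMetric.diffAt_extend w
  simp only [TwoForm.extDeriv, mlieBracket_eq_leviCivita_sub g hX hY,
    mlieBracket_eq_leviCivita_sub g hX hZ, mlieBracket_eq_leviCivita_sub g hY hZ, h _ _ _ hX hY,
    h _ _ _ hX hZ, h _ _ _ hY hZ, FiberBundle.extend_apply_self, map_sub, _root_.sub_apply,
    φ.form_swap x u, φ.form_swap x v, φ.form_swap x w]
  ring

theorem IsConformalKillingYano.exists_hasCovDerivAt (hφ : IsConformalKillingYano g φ) (x : M) :
    ∃ K : Module.Dual ℝ (TangentSpace (𝓡 n) x), φ.HasCovDerivAt g x fun u y z ↦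
      1 / 3 * φ.extDeriv x u y z +
        1 / ((n : ℝ) - 1) * (g.form x u y * K z - g.form x u z * K y) := by
  obtain ⟨τ, K, h⟩ := hφ
  have hcov : φ.HasCovDerivAt g x fun u y z ↦ 1 / 3 * τ x ![u, y, z] +
      1 / ((n : ℝ) - 1) * (g.form x u y * K x z - g.form x u z * K x y) :=
    fun u Y Z hY hZ ↦ by
      have := h x u Y Z hY hZ
      rw [covDeriv] at this
      linear_combination this
  have hτ (u v w) : φ.extDeriv x u v w = τ x ![u, v, w] := by
    have swap₁₂ : τ x ![v, u, w] = -τ x ![u, v, w] := by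
      rw [← (τ x).map_swap _ (show (0 : Fin 3) ≠ 1 by decide)]
      congr 1; ext i; fin_cases i <;> rfl
    have rotate : τ x ![w, u, v] = τ x ![u, v, w] := by
      rw [← neg_neg (τ x ![u, v, w]), ← swap₁₂,
        ← (τ x).map_swap _ (show (0 : Fin 3) ≠ 2 by decide)]
      congr 1; ext i; fin_cases i <;> rfl
    rw [extDeriv_eq_of_hasCovDerivAt hcov, swap₁₂, rotate, g.symm x v u, g.symm x w u, g.symm x w v]
    ring
  exact ⟨K x, by simpa only [hτ] using hcov⟩

theorem extDeriv_swap₁₂ (u v w : TangentSpace (𝓡 n) x) :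
    φ.extDeriv x v u w = -φ.extDeriv x u v w := by
  have hneg (Y Z : Π x : M, TangentSpace (𝓡 n) x) :
      (fun y ↦ φ.form y (Z y) (Y y)) = -fun y ↦ φ.form y (Y y) (Z y) :=
    funext fun y ↦ φ.form_swap y (Y y) (Z y)
  simp only [TwoForm.extDeriv, hneg (FiberBundle.extend _ u) (FiberBundle.extend _ v),
    mvfderiv_neg, VectorField.mlieBracket_swap_apply (V := FiberBundle.extend _ v)
      (W := FiberBundle.extend _ u), map_neg, _root_.neg_apply]
  ring

theorem extDeriv_swap₂₃ (u v w : TangentSpace (𝓡 n) x) :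
    φ.extDeriv x u w v = -φ.extDeriv x u v w := by
  have hneg (Y Z : Π x : M, TangentSpace (𝓡 n) x) :
      (fun y ↦ φ.form y (Z y) (Y y)) = -fun y ↦ φ.form y (Y y) (Z y) :=
    funext fun y ↦ φ.form_swap y (Y y) (Z y)
  simp only [TwoForm.extDeriv, hneg (FiberBundle.extend _ v) (FiberBundle.extend _ w),
    mvfderiv_neg, VectorField.mlieBracket_swap_apply (V := FiberBundle.extend _ w)
      (W := FiberBundle.extend _ v), map_neg, _root_.neg_apply]
  ring

end Connection

section ComplexConnection

theorem rePart_baseChange {T T' : Type*} [AddCommGroup T] [Module ℝ T] [AddCommGroup T']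
    [Module ℝ T'] (L : T →ₗ[ℝ] T') (z : ℂ ⊗[ℝ] T) : rePart (L.baseChange ℂ z) = L (rePart z) := by
  induction z using TensorProduct.induction_on with
  | zero => simp
  | add a b ha hb => simp only [map_add, ha, hb]
  | tmul c t => simp [rePart_tmul]

theorem imPart_baseChange {T T' : Type*} [AddCommGroup T] [Module ℝ T] [AddCommGroup T']
    [Module ℝ T'] (L : T →ₗ[ℝ] T') (z : ℂ ⊗[ℝ] T) : imPart (L.baseChange ℂ z) = L (imPart z) := by
  induction z using TensorProduct.induction_on with
  | zero => simp
  | add a b ha hb => simp only [map_add, ha, hb]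
  | tmul c t => simp [imPart_tmul]

variable {n : ℕ} {M : Type*} [TopologicalSpace M] [ChartedSpace (EuclideanSpace ℝ (Fin n)) M]
  [IsManifold (𝓡 n) ∞ M]

/-- The (rough) complex vector field `Z` is differentiable at `x`. -/
def CDiffAt (Z : Π x : M, CTangent n x) (x : M) : Prop :=
  DiffAt (fun y ↦ rePart (Z y)) x ∧ DiffAt (fun y ↦ imPart (Z y)) x

theorem SmoothFieldOn.cDiffAt {Z : Π x : M, CTangent n x} {U : Set M} (h : SmoothFieldOn Z U)
    (hU : IsOpen U) {x : M} (hx : x ∈ U) : CDiffAt Z x :=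
  ⟨(h.1.contMDiffAt (hU.mem_nhds hx)).mdifferentiableAt (by simp),
    (h.2.contMDiffAt (hU.mem_nhds hx)).mdifferentiableAt (by simp)⟩

/-- The covariant derivative `a ↦ ∇_a Z` of a complex vector field at `x`, for the complex-linear
extension of the Levi-Civita connection of `g`. -/
def complexCov (g : PseudoRiemannianMetric n M) (Z : Π x : M, CTangent n x) (x : M) :
    End ℂ (CTangent n x) :=
  (g.leviCivita (fun y ↦ rePart (Z y)) x).toLinearMap.baseChange ℂ +
    Complex.I • (g.leviCivita (fun y ↦ imPart (Z y)) x).toLinearMap.baseChange ℂ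

variable {g : PseudoRiemannianMetric n M} {φ : TwoForm n M} {x : M} {A B : Π x : M, CTangent n x}

theorem rePart_complexCov (a : CTangent n x) : rePart (complexCov g A x a) =
    g.leviCivita (fun y ↦ rePart (A y)) x (rePart a) -
      g.leviCivita (fun y ↦ imPart (A y)) x (imPart a) := by
  simp [complexCov, rePart_smul, rePart_baseChange, imPart_baseChange, sub_eq_add_neg]

theorem imPart_complexCov (a : CTangent n x) : imPart (complexCov g A x a) =
    g.leviCivita (fun y ↦ rePart (A y)) x (imPart a) +
      g.leviCivita (fun y ↦ imPart (A y)) x (rePart a) := by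
  simp [complexCov, imPart_smul, rePart_baseChange, imPart_baseChange]

theorem lieBracketC_eq_complexCov_sub (g : PseudoRiemannianMetric n M) (hA : CDiffAt A x)
    (hB : CDiffAt B x) :
    lieBracketC A B x = complexCov g B x (A x) - complexCov g A x (B x) := by
  rw [lieBracketC, mlieBracket_eq_leviCivita_sub g hA.1 hB.1,
    mlieBracket_eq_leviCivita_sub g hA.2 hB.2, mlieBracket_eq_leviCivita_sub g hA.1 hB.2,
    mlieBracket_eq_leviCivita_sub g hA.2 hB.1]
  apply ext_parts
  · simp only [rePart_ofParts, map_sub, rePart_complexCov]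
    abel
  · simp only [imPart_ofParts, map_sub, imPart_complexCov]
    abel

theorem Tensor2.HasCovDerivAt.complex_eq_zero {t : Tensor2 n M}
    {q : TangentSpace (𝓡 n) x → TangentSpace (𝓡 n) x → TangentSpace (𝓡 n) x → ℝ}
    (h : t.HasCovDerivAt g x q) (hA : CDiffAt A x) (hB : CDiffAt B x) {c : ℂ}
    (hc : ∀ᶠ y in 𝓝 x, t.complexForm y (A y) (B y) = c) (a : CTangent n x) :
    cExt₃ q a (A x) (B x) + t.complexForm x (complexCov g A x a) (B x) +
      t.complexForm x (A x) (complexCov g B x a) = 0 := by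
  simp only [Tensor2.complexForm_apply, cExt₂, cExt] at hc
  have hre : (fun y ↦ t.form y (rePart (A y)) (rePart (B y)) -
      t.form y (imPart (A y)) (imPart (B y))) =ᶠ[𝓝 x] fun _ ↦ c.re := by
    filter_upwards [hc] with y hy
    simpa [sub_eq_add_neg] using congr(($hy).re)
  have him : (fun y ↦ t.form y (rePart (A y)) (imPart (B y)) +
      t.form y (imPart (A y)) (rePart (B y))) =ᶠ[𝓝 x] fun _ ↦ c.im := by
    filter_upwards [hc] with y hy
    simpa using congr(($hy).im)
  have hdre (u : TangentSpace (𝓡 n) x) := congr($((mvfderiv_fun_sub (t.mdiff hA.1 hB.1)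
    (t.mdiff hA.2 hB.2)).symm.trans (mvfderiv_eq_zero_of_eventuallyEq_const hre)) u)
  have hdim (u : TangentSpace (𝓡 n) x) := congr($((mvfderiv_fun_add (t.mdiff hA.1 hB.2)
    (t.mdiff hA.2 hB.1)).symm.trans (mvfderiv_eq_zero_of_eventuallyEq_const him)) u)
  simp only [_root_.sub_apply, _root_.zero_apply, h _ _ _ hA.1 hB.1, h _ _ _ hA.2 hB.2] at hdre
  simp only [_root_.add_apply, _root_.zero_apply, h _ _ _ hA.1 hB.2, h _ _ _ hA.2 hB.1] at hdim
  simp only [Tensor2.complexForm_apply, cExt₃, cExt₂, cExt, rePart_complexCov, imPart_complexCov,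
    map_sub, map_add, _root_.sub_apply, _root_.add_apply]
  apply Complex.ext
  · simp only [Complex.add_re, Complex.add_im, Complex.I_mul_re, Complex.I_mul_im,
      Complex.ofReal_re, Complex.ofReal_im, Complex.zero_re]
    linarith [hdre (rePart a), hdim (imPart a)]
  · simp only [Complex.add_re, Complex.add_im, Complex.I_mul_re, Complex.I_mul_im,
      Complex.ofReal_re, Complex.ofReal_im, Complex.zero_im]
    linarith [hdre (imPart a), hdim (rePart a)]

theorem complexForm_complexCov_add_eq_zero (hA : CDiffAt A x) (hB : CDiffAt B x) {c : ℂ}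
    (hc : ∀ᶠ y in 𝓝 x, g.complexForm y (A y) (B y) = c) (a : CTangent n x) :
    g.complexForm x (complexCov g A x a) (B x) +
      g.complexForm x (A x) (complexCov g B x a) = 0 := by
  simpa [cExt₃, cExt₂, cExt] using (g.hasCovDerivAt_zero x).complex_eq_zero hA hB hc a

theorem IsConformalKillingYano.complexForm_complexCov_add_eq_zero
    (hφ : IsConformalKillingYano g φ) (hA : CDiffAt A x) (hB : CDiffAt B x) {c : ℂ}
    (hc : ∀ᶠ y in 𝓝 x, φ.complexForm y (A y) (B y) = c) {a : CTangent n x}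
    (haA : g.complexForm x a (A x) = 0) (haB : g.complexForm x a (B x) = 0) :
    1 / 3 * extDerivC φ x a (A x) (B x) + φ.complexForm x (complexCov g A x a) (B x) +
      φ.complexForm x (A x) (complexCov g B x a) = 0 := by
  obtain ⟨K, hK⟩ := hφ.exists_hasCovDerivAt x
  have hexpand : cExt₃ (fun u y z ↦ 1 / 3 * φ.extDeriv x u y z +
        1 / ((n : ℝ) - 1) * (g.form x u y * K z - g.form x u z * K y)) a (A x) (B x) =
      1 / 3 * extDerivC φ x a (A x) (B x) + 1 / ((n : ℂ) - 1) *
        (g.complexForm x a (A x) * cExt (fun b ↦ (K b : ℂ)) (B x) -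
          g.complexForm x a (B x) * cExt (fun b ↦ (K b : ℂ)) (A x)) := by
    simp only [extDerivC, cExt₃, cExt₂, cExt, Tensor2.complexForm_apply]
    push_cast
    ring
  have := hK.complex_eq_zero hA hB hc a
  rwa [hexpand, haA, haB, zero_mul, zero_mul, sub_zero, mul_zero, add_zero] at this

theorem complexForm_complexCov_eq_zero (hφ : IsConformalKillingYano g φ) (hA : CDiffAt A x)
    (hB : CDiffAt B x) {c d : ℂ} (hcA : complexRaise g φ x (A x) = c • A x)
    (hdB : complexRaise g φ x (B x) = d • B x) (hcd : c + d ≠ 0)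
    (hg : ∀ᶠ y in 𝓝 x, g.complexForm y (A y) (B y) = 0)
    (hφ₀ : ∀ᶠ y in 𝓝 x, φ.complexForm y (A y) (B y) = 0) {a : CTangent n x}
    (haA : g.complexForm x a (A x) = 0) (haB : g.complexForm x a (B x) = 0)
    (hτ : extDerivC φ x a (A x) (B x) = 0) :
    g.complexForm x (complexCov g A x a) (B x) = 0 := by
  have hgrel := complexForm_complexCov_add_eq_zero hA hB hg a
  have hφrel := hφ.complexForm_complexCov_add_eq_zero hA hB hφ₀ haA haB
  rw [hτ, φ.complexForm_swap x (B x), (complexRaise_eq_smul_iff g φ).1 hcA,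
    (complexRaise_eq_smul_iff g φ).1 hdB, g.complexForm_comm x (B x)] at hφrel
  refine (mul_eq_zero.1 ?_).resolve_left hcd
  linear_combination c * hgrel - hφrel

/-- By compatibility and absence of torsion,
`g([Y, Z], C) = g(∇_Y Z - ∇_Z Y, C) = g(Y, ∇_Z C) - g(Z, ∇_Y C)` for sections `Y`, `Z` of `D`. -/
theorem isIntegrableOn_of_mem_iff {D : Π x : M, Submodule ℂ (CTangent n x)} {U : Set M}
    (hU : IsOpen U) {ι : Type*} {C : ι → Π x : M, CTangent n x} (hC : ∀ j, SmoothFieldOn (C j) U)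
    (hD : ∀ x ∈ U, ∀ z, z ∈ D x ↔ ∀ j, g.complexForm x z (C j x) = 0)
    {S : Π x : M, Set (CTangent n x)} (hS : ∀ x ∈ U, D x = Submodule.span ℂ (S x))
    (hsymm : ∀ x ∈ U, ∀ j, ∀ a ∈ S x, ∀ b ∈ S x,
      g.complexForm x a (complexCov g (C j) x b) = g.complexForm x b (complexCov g (C j) x a)) :
    IsIntegrableOn D U := by
  intro U' hU'U hU' Y Z hY hZ hYD hZD x hx
  have hxU := hU'U hx
  have hYx := hY.cDiffAt hU' hx
  have hZx := hZ.cDiffAt hU' hx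
  rw [hD x hxU]
  intro j
  have hCx := (hC j).cDiffAt hU hxU
  have hYC : ∀ᶠ y in 𝓝 x, g.complexForm y (Y y) (C j y) = 0 := by
    filter_upwards [hU'.mem_nhds hx] with y hy using (hD y (hU'U hy) _).1 (hYD y hy) j
  have hZC : ∀ᶠ y in 𝓝 x, g.complexForm y (Z y) (C j y) = 0 := by
    filter_upwards [hU'.mem_nhds hx] with y hy using (hD y (hU'U hy) _).1 (hZD y hy) j
  have hYS := hYD x hx
  have hZS := hZD x hx
  rw [hS x hxU] at hYS hZS
  have hswap := apply_eq_apply_swap_of_mem_span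
    (B := (g.complexForm x).compl₂ (complexCov g (C j) x)) (hsymm x hxU j) hYS hZS
  simp only [LinearMap.compl₂_apply] at hswap
  rw [lieBracketC_eq_complexCov_sub g hYx hZx, map_sub, LinearMap.sub_apply]
  linear_combination complexForm_complexCov_add_eq_zero hZx hCx hZC (Y x) -
    complexForm_complexCov_add_eq_zero hYx hCx hYC (Z x) + hswap

end ComplexConnection

section Frames

variable {m : ℕ} {M : Type*} [TopologicalSpace M]
  [ChartedSpace (EuclideanSpace ℝ (Fin (2 * m + 1))) M] [IsManifold (𝓡 (2 * m + 1)) ∞ M]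
  {g : PseudoRiemannianMetric (2 * m + 1) M} {φ : TwoForm (2 * m + 1) M} {U : Set M} {x : M}
  {lam : Fin m → M → ℂ} {V0 : Π x : M, CTangent (2 * m + 1) x}
  {V W : Fin m → Π x : M, CTangent (2 * m + 1) x}

theorem IsNormalBasisAt.extDerivC_v_v_v0 {lam : Fin m → ℂ} {v0 : CTangent (2 * m + 1) x}
    {v w : Fin m → CTangent (2 * m + 1) x} (h : IsNormalBasisAt g φ x lam v0 v w)
    (hτ : TauConditionAt m g φ x) (i j : Fin m) : extDerivC φ x (v i) (v j) v0 = 0 := by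
  obtain rfl | hij := eq_or_ne i j
  · exact self_eq_neg.1 (cExt₃_swap₁₂ extDeriv_swap₁₂ _ _ _)
  · exact ((hτ _ _ _ _ h).2.2 i j hij).1

namespace IsNormalFrameOn

theorem flip (h : IsNormalFrameOn g φ U lam V0 V W) (s : Fin m → Bool) :
    IsNormalFrameOn g φ U (fun i x ↦ if s i then lam i x else -lam i x) V0
      (fun i x ↦ if s i then V i x else W i x) (fun i x ↦ if s i then W i x else V i x) where
  smooth_V0 := h.smooth_V0
  smooth_V i := by cases hi : s i <;> simp [h.smooth_V, h.smooth_W]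
  smooth_W i := by cases hi : s i <;> simp [h.smooth_V, h.smooth_W]
  normal x hx := (h.normal x hx).flip s

theorem isSubbundleOn_span (h : IsNormalFrameOn g φ U lam V0 V W) (hU : IsOpen U) :
    IsSubbundleOn m (fun x ↦ Submodule.span ℂ (Set.range fun i ↦ V i x)) U :=
  fun _ hx ↦ ⟨U, subset_rfl, hU, hx, V, h.smooth_V, fun y hy ↦ ⟨(h.normal y hy).linearIndependent,
    rfl⟩⟩

theorem isSubbundleOn_span_sup (h : IsNormalFrameOn g φ U lam V0 V W) (hU : IsOpen U) :
    IsSubbundleOn (m + 1)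
      (fun x ↦ Submodule.span ℂ (Set.range fun i ↦ V i x) ⊔ Submodule.span ℂ {V0 x}) U := by
  refine fun _ hx ↦ ⟨U, subset_rfl, hU, hx, Fin.cons V0 V, fun i ↦ ?_, fun y hy ↦ ?_⟩
  · cases i using Fin.cases with
    | zero => exact h.smooth_V0
    | succ i => exact h.smooth_V i
  · have hcons : (fun i ↦ (Fin.cons V0 V : Fin (m + 1) → Π x : M, CTangent (2 * m + 1) x) i y) =
        Fin.cons (V0 y) fun i ↦ V i y := by
      ext i
      cases i using Fin.cases <;> rfl
    rw [hcons, Fin.range_cons, Submodule.span_insert, sup_comm]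
    exact ⟨(h.normal y hy).linearIndependent_finCons, rfl⟩

theorem smooth_normalFamily (h : IsNormalFrameOn g φ U lam V0 V W) :
    ∀ a, SmoothFieldOn (normalFamily V0 V W a) U
  | none => h.smooth_V0
  | some (.inl i) => h.smooth_V i
  | some (.inr i) => h.smooth_W i

theorem complexForm_complexCov_normalFamily (h : IsNormalFrameOn g φ U lam V0 V W)
    (hφ : IsConformalKillingYano g φ) (hU : IsOpen U) (hx : x ∈ U) {a b c : NormalIndex m}
    (hab : b ≠ a.swap) (hca : a ≠ c.swap) (hcb : b ≠ c.swap)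
    (hlam : normalFamily 0 lam (-lam) a x + normalFamily 0 lam (-lam) b x ≠ 0)
    (hτ : extDerivC φ x (normalFamily V0 V W c x) (normalFamily V0 V W a x)
      (normalFamily V0 V W b x) = 0) :
    g.complexForm x (complexCov g (normalFamily V0 V W a) x (normalFamily V0 V W c x))
      (normalFamily V0 V W b x) = 0 := by
  have hE (y : M) (a : NormalIndex m) : normalFamily V0 V W a y =
      normalFamily (V0 y) (fun i ↦ V i y) (fun i ↦ W i y) a := by rcases a with _ | _ | _ <;> rfl
  have hL (a : NormalIndex m) : normalFamily 0 lam (-lam) a x =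
      normalFamily 0 (fun i ↦ lam i x) (-fun i ↦ lam i x) a := by rcases a with _ | _ | _ <;> rfl
  have hpair {y : M} (hy : y ∈ U) {a b : NormalIndex m} (hab : b ≠ a.swap) :
      g.complexForm y (normalFamily V0 V W a y) (normalFamily V0 V W b y) = 0 ∧
        φ.complexForm y (normalFamily V0 V W a y) (normalFamily V0 V W b y) = 0 := by
    simpa only [hE, hab, if_false] using isNormalBasisAt_iff.1 (h.normal y hy) a b
  have heigen (a : NormalIndex m) : complexRaise g φ x (normalFamily V0 V W a x) =
      normalFamily 0 lam (-lam) a x • normalFamily V0 V W a x := by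
    rw [hE, hL]
    exact (h.normal x hx).complexRaise_normalFamily a
  have hUx := hU.mem_nhds hx
  exact complexForm_complexCov_eq_zero hφ ((h.smooth_normalFamily a).cDiffAt hU hx)
    ((h.smooth_normalFamily b).cDiffAt hU hx) (heigen a) (heigen b) hlam
    (by filter_upwards [hUx] with y hy using (hpair hy hab).1)
    (by filter_upwards [hUx] with y hy using (hpair hy hab).2) (hpair hx hca).1 (hpair hx hcb).1 hτ

section Integrability

variable (h : IsNormalFrameOn g φ U lam V0 V W) (hφ : IsConformalKillingYano g φ) (hU : IsOpen U)
  (hgen : ∀ x ∈ U, IsGenericAt m g φ x) (hτ : ∀ x ∈ U, TauConditionAt m g φ x)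
include h hφ hU hgen hτ

theorem complexForm_complexCov_V_V (hx : x ∈ U) (i j k : Fin m) :
    g.complexForm x (complexCov g (V i) x (V k x)) (V j x) = 0 :=
  h.complexForm_complexCov_normalFamily hφ hU hx (a := some (.inl i)) (b := some (.inl j))
    (c := some (.inl k)) (by simp [NormalIndex.swap]) (by simp [NormalIndex.swap])
    (by simp [NormalIndex.swap]) ((h.normal x hx).eigenvalue_add_ne_zero (hgen x hx) i j)
    ((hτ x hx _ _ _ _ (h.normal x hx)).1 k i j).1

theorem complexForm_complexCov_V_V0 (hx : x ∈ U) (i k : Fin m) :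
    g.complexForm x (complexCov g (V i) x (V k x)) (V0 x) = 0 :=
  h.complexForm_complexCov_normalFamily hφ hU hx (a := some (.inl i)) (b := none)
    (c := some (.inl k)) (by simp [NormalIndex.swap]) (by simp [NormalIndex.swap])
    (by simp [NormalIndex.swap])
    (by simpa [normalFamily] using (h.normal x hx).eigenvalue_add_ne_zero (hgen x hx) i i)
    ((h.normal x hx).extDerivC_v_v_v0 (hτ x hx) k i)

theorem complexForm_complexCov_V0_V (hx : x ∈ U) (i k : Fin m) :
    g.complexForm x (complexCov g V0 x (V k x)) (V i x) = 0 :=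
  h.complexForm_complexCov_normalFamily hφ hU hx (a := none) (b := some (.inl i))
    (c := some (.inl k)) (by simp [NormalIndex.swap]) (by simp [NormalIndex.swap])
    (by simp [NormalIndex.swap])
    (by simpa [normalFamily] using (h.normal x hx).eigenvalue_add_ne_zero (hgen x hx) i i)
    (by
      refine (cExt₃_swap₂₃ extDeriv_swap₂₃ _ _ _).trans (neg_eq_zero.2 ?_)
      exact (h.normal x hx).extDerivC_v_v_v0 (hτ x hx) k i)

theorem complexForm_complexCov_V_V_along_V0 (hx : x ∈ U) (i j : Fin m) :
    g.complexForm x (complexCov g (V i) x (V0 x)) (V j x) = 0 :=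
  h.complexForm_complexCov_normalFamily hφ hU hx (a := some (.inl i)) (b := some (.inl j))
    (c := none) (by simp [NormalIndex.swap]) (by simp [NormalIndex.swap])
    (by simp [NormalIndex.swap]) ((h.normal x hx).eigenvalue_add_ne_zero (hgen x hx) i j)
    (by
      refine (cExt₃_swap₁₂ extDeriv_swap₁₂ _ _ _).trans (neg_eq_zero.2 ?_)
      refine (cExt₃_swap₂₃ extDeriv_swap₂₃ _ _ _).trans (neg_eq_zero.2 ?_)
      exact (h.normal x hx).extDerivC_v_v_v0 (hτ x hx) i j)

theorem isIntegrableOn_span :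
    IsIntegrableOn (fun x ↦ Submodule.span ℂ (Set.range fun i ↦ V i x)) U := by
  refine isIntegrableOn_of_mem_iff (C := fun o : Option (Fin m) ↦ o.elim V0 V) (g := g) hU
    (Option.forall.2 ⟨h.smooth_V0, h.smooth_V⟩)
    (fun x hx z ↦ by simpa [Option.forall] using (h.normal x hx).mem_span_range_iff)
    (fun _ _ ↦ rfl) ?_
  rintro x hx (_ | i) _ ⟨j, rfl⟩ _ ⟨k, rfl⟩ <;>
    simp only [g.complexForm_comm x (V _ x), Option.elim]
  · rw [h.complexForm_complexCov_V0_V hφ hU hgen hτ hx,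
      h.complexForm_complexCov_V0_V hφ hU hgen hτ hx]
  · rw [h.complexForm_complexCov_V_V hφ hU hgen hτ hx,
      h.complexForm_complexCov_V_V hφ hU hgen hτ hx]

theorem isIntegrableOn_span_sup : IsIntegrableOn
    (fun x ↦ Submodule.span ℂ (Set.range fun i ↦ V i x) ⊔ Submodule.span ℂ {V0 x}) U := by
  refine isIntegrableOn_of_mem_iff (g := g) hU h.smooth_V
    (fun x hx z ↦ (h.normal x hx).mem_span_range_sup_iff)
    (fun _ _ ↦ (Submodule.span_union _ _).symm) ?_
  have hV {x : M} (hx : x ∈ U) (i k : Fin m) : g.complexForm x (V k x)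
      (complexCov g (V i) x (V0 x)) = g.complexForm x (V0 x) (complexCov g (V i) x (V k x)) := by
    rw [g.complexForm_comm, g.complexForm_comm x (V0 x),
      h.complexForm_complexCov_V_V_along_V0 hφ hU hgen hτ hx,
      h.complexForm_complexCov_V_V0 hφ hU hgen hτ hx]
  rintro x hx i _ (⟨j, rfl⟩ | rfl) _ (⟨k, rfl⟩ | rfl)
  · simp only [g.complexForm_comm x (V _ x)]
    rw [h.complexForm_complexCov_V_V hφ hU hgen hτ hx,
      h.complexForm_complexCov_V_V hφ hU hgen hτ hx]
  · exact hV hx i j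
  · exact (hV hx i k).symm
  · rfl

end Integrability

end IsNormalFrameOn

end Frames

section Pairing

theorem exists_equiv_sum_of_involutive {α : Type*} [Finite α] {m : ℕ} (hα : Nat.card α = 2 * m)
    {σ : α → α} (hσ : Function.Involutive σ) (hne : ∀ a, σ a ≠ a) :
    ∃ e : Fin m ⊕ Fin m ≃ α, ∀ i, e (.inr i) = σ (e (.inl i)) := by
  classical
  let : LinearOrder α := .lift' _ (Finite.equivFin α).injective
  let swap : {a // a < σ a} ≃ {a // ¬a < σ a} := hσ.toPerm.subtypeEquiv fun a ↦ by
    simpa [hσ a] using ⟨le_of_lt, fun h ↦ h.lt_of_ne (hne a).symm⟩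
  have hcard : Nat.card {a // a < σ a} = m := by
    have := Nat.card_congr (Equiv.sumCompl fun a ↦ a < σ a)
    rw [Nat.card_sum, ← Nat.card_congr swap, hα] at this
    lia
  let half := (Finite.equivFinOfCardEq hcard).symm
  exact ⟨(Equiv.sumCongr half (half.trans swap)).trans (Equiv.sumCompl _), fun i ↦ rfl⟩

end Pairing

section SquareRoot

theorem exists_analyticAt_sq_eq {c : ℂ} (hc : c ≠ 0) :
    ∃ s : ℂ → ℂ, AnalyticAt ℂ s c ∧ ∀ z, s z ^ 2 = z := by
  obtain ⟨r, hr⟩ := IsAlgClosed.exists_pow_nat_eq c two_pos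
  refine ⟨fun z ↦ (z / c) ^ (2⁻¹ : ℂ) * r, ?_, fun z ↦ ?_⟩
  · refine ((analyticAt_id.div analyticAt_const hc).cpow analyticAt_const ?_).mul analyticAt_const
    simp [hc]
  · rw [mul_pow, Complex.cpow_ofNat_inv_pow, hr, div_mul_cancel₀ z hc]

end SquareRoot

section Pencil

variable {𝕜 E F : Type*} [RCLike 𝕜] [NormedAddCommGroup E] [NormedSpace 𝕜 E]
  [NormedAddCommGroup F] [NormedSpace 𝕜 F]

/-- The map `((P, G), (c, v)) ↦ (P v - c G v, l v)`. Its fibre over `(0, 1)` consists of the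
eigenpairs `(c, v)` of the pencil `P - c G`, normalized by `l v = 1`. -/
def pencilMap (l : E →L[𝕜] 𝕜) (p : ((E →L[𝕜] F) × (E →L[𝕜] F)) × (𝕜 × E)) : F × 𝕜 :=
  (p.1.1 p.2.2 - p.2.1 • p.1.2 p.2.2, l p.2.2)

theorem contDiff_pencilMap (l : E →L[𝕜] 𝕜) : ContDiff 𝕜 ω (pencilMap (F := F) l) := by
  unfold pencilMap
  fun_prop

variable {l : E →L[𝕜] 𝕜} {P G : E →L[𝕜] F} {c : 𝕜} {v : E}

theorem fderiv_pencilMap_inr (c' : 𝕜) (v' : E) :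
    fderiv 𝕜 (pencilMap l) ((P, G), (c, v)) (0, (c', v')) =
      (P v' - (c • G v' + c' • G v), l v') := by
  have hpartial : HasFDerivAt (fun q : 𝕜 × E ↦ pencilMap l ((P, G), q))
      (fderiv 𝕜 (pencilMap l) ((P, G), (c, v)) ∘L .inr 𝕜 _ _) (c, v) :=
    (((contDiff_pencilMap l).contDiffAt.differentiableAt (by simp)).hasFDerivAt).comp (c, v)
      (hasFDerivAt_prodMk_right (P, G) (c, v))
  have hformula : HasFDerivAt (fun q : 𝕜 × E ↦ pencilMap l ((P, G), q)) _ (c, v) :=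
    ((P ∘L .snd 𝕜 𝕜 E).hasFDerivAt.sub (hasFDerivAt_fst.fun_smul
      (G ∘L .snd 𝕜 𝕜 E).hasFDerivAt)).prodMk (l ∘L .snd 𝕜 𝕜 E).hasFDerivAt
  simpa using congr($(hpartial.unique hformula) (c', v'))

variable [FiniteDimensional 𝕜 E] [FiniteDimensional 𝕜 F]

theorem isInvertible_fderiv_pencilMap (hEF : finrank 𝕜 E = finrank 𝕜 F) (hl : l v = 1)
    (hsimple : ∀ (v' : E) (c' : 𝕜), P v' - c • G v' = c' • G v →
      c' = 0 ∧ v' ∈ Submodule.span 𝕜 {v}) :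
    (fderiv 𝕜 (pencilMap l) ((P, G), (c, v)) ∘L .inr 𝕜 _ _).IsInvertible := by
  set L := fderiv 𝕜 (pencilMap l) ((P, G), (c, v)) ∘L .inr 𝕜 _ _ with hL
  have hinj : Function.Injective L := by
    rw [injective_iff_map_eq_zero]
    rintro ⟨c', v'⟩ h0
    rw [hL, ContinuousLinearMap.comp_apply, ContinuousLinearMap.inr_apply, fderiv_pencilMap_inr,
      Prod.mk_eq_zero, ← sub_sub, sub_eq_zero] at h0
    obtain ⟨rfl, hv'⟩ := hsimple v' c' h0.1
    obtain ⟨t, rfl⟩ := Submodule.mem_span_singleton.1 hv'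
    have ht : t = 0 := by simpa [hl] using h0.2
    simp [ht]
  exact ⟨(LinearMap.linearEquivOfInjective L.toLinearMap hinj
    (by simp [add_comm, hEF])).toContinuousLinearEquiv, by ext <;> rfl⟩

theorem exists_contDiffAt_eigenpair (hEF : finrank 𝕜 E = finrank 𝕜 F) (hv : v ≠ 0)
    (h : P v = c • G v)
    (hsimple : ∀ (v' : E) (c' : 𝕜), P v' - c • G v' = c' • G v →
      c' = 0 ∧ v' ∈ Submodule.span 𝕜 {v}) :
    ∃ f : (E →L[𝕜] F) × (E →L[𝕜] F) → 𝕜 × E, f (P, G) = (c, v) ∧ ContDiffAt 𝕜 ω f (P, G) ∧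
      ∀ᶠ p in 𝓝 (P, G), p.1 (f p).2 = (f p).1 • p.2 (f p).2 := by
  have : CompleteSpace E := FiniteDimensional.complete 𝕜 E
  have : CompleteSpace F := FiniteDimensional.complete 𝕜 F
  obtain ⟨l, hl⟩ := SeparatingDual.exists_eq_one (R := 𝕜) hv
  have hinv := isInvertible_fderiv_pencilMap hEF hl hsimple
  have hω : (ω : WithTop ℕ∞) ≠ 0 := by simp
  have hsmooth := (contDiff_pencilMap (F := F) l).contDiffAt (x := ((P, G), (c, v)))
  refine ⟨hsmooth.implicitFunction hω hinv, hsmooth.implicitFunction_apply_self hω hinv,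
    hsmooth.contDiffAt_implicitFunction hω hinv, ?_⟩
  filter_upwards [hsmooth.eventually_apply_implicitFunction hω hinv] with p hp
  simpa [pencilMap, h, sub_eq_zero] using congr(($hp).1)

end Pencil

section SmoothFields

variable {n : ℕ} {M : Type*} [TopologicalSpace M] [ChartedSpace (EuclideanSpace ℝ (Fin n)) M]
  [IsManifold (𝓡 n) ∞ M]

/-- The real vector field `X` is smooth at `x`. -/
abbrev RealSmoothAt (X : Π x : M, TangentSpace (𝓡 n) x) (x : M) : Prop :=
  ContMDiffAt (𝓡 n) (𝓡 n).tangent ∞ (fun y ↦ (⟨y, X y⟩ : TangentBundle (𝓡 n) M)) x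

/-- The complex vector field `Z` is smooth at `x`: the pointwise version of `SmoothFieldOn`. -/
def SmoothFieldAt (Z : Π x : M, CTangent n x) (x : M) : Prop :=
  RealSmoothAt (fun y ↦ rePart (Z y)) x ∧ RealSmoothAt (fun y ↦ imPart (Z y)) x

variable {x : M}

theorem smoothFieldOn_of_forall_smoothFieldAt {Z : Π x : M, CTangent n x} {U : Set M}
    (h : ∀ x ∈ U, SmoothFieldAt Z x) : SmoothFieldOn Z U :=
  ⟨fun x hx ↦ (h x hx).1.contMDiffWithinAt, fun x hx ↦ (h x hx).2.contMDiffWithinAt⟩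

theorem SmoothFieldAt.smul {f : M → ℂ} {Z : Π x : M, CTangent n x}
    (hf : ContMDiffAt (𝓡 n) 𝓘(ℝ, ℂ) ∞ f x) (hZ : SmoothFieldAt Z x) :
    SmoothFieldAt (fun y ↦ f y • Z y) x := by
  have hre : ContMDiffAt (𝓡 n) 𝓘(ℝ, ℝ) ∞ (fun y ↦ (f y).re) x :=
    Complex.reCLM.contDiff.contMDiff.contMDiffAt.comp x hf
  have him : ContMDiffAt (𝓡 n) 𝓘(ℝ, ℝ) ∞ (fun y ↦ (f y).im) x :=
    Complex.imCLM.contDiff.contMDiff.contMDiffAt.comp x hf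
  constructor
  · simp only [rePart_smul]
    exact (hre.smul_section hZ.1).sub_section (him.smul_section hZ.2)
  · simp only [imPart_smul]
    exact (hre.smul_section hZ.2).add_section (him.smul_section hZ.1)

theorem Tensor2.contMDiffAt_form (t : Tensor2 n M) {X Y : Π x : M, TangentSpace (𝓡 n) x}
    (hX : RealSmoothAt X x) (hY : RealSmoothAt Y x) :
    ContMDiffAt (𝓡 n) 𝓘(ℝ, ℝ) ∞ (fun y ↦ t.form y (X y) (Y y)) x := by
  have hsection : ContMDiffAt (𝓡 n) ((𝓡 n).prod 𝓘(ℝ)) ∞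
      (fun y ↦ TotalSpace.mk' ℝ (E := Bundle.Trivial M ℝ) y (t.form y (X y) (Y y))) x :=
    ContMDiffAt.clm_bundle_apply₂ (F₁ := EuclideanSpace ℝ (Fin n))
      (F₂ := EuclideanSpace ℝ (Fin n)) t.smooth.contMDiffAt hX hY
  exact (contMDiffAt_totalSpace.1 hsection).2

theorem Tensor2.contMDiffAt_complexForm (t : Tensor2 n M) {A B : Π x : M, CTangent n x}
    (hA : SmoothFieldAt A x) (hB : SmoothFieldAt B x) :
    ContMDiffAt (𝓡 n) 𝓘(ℝ, ℂ) ∞ (fun y ↦ t.complexForm y (A y) (B y)) x := by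
  have hcombine : ContDiff ℝ ∞ fun p : (ℝ × ℝ) × (ℝ × ℝ) ↦
      (Complex.ofRealCLM p.1.1 + Complex.I * Complex.ofRealCLM p.1.2) +
        Complex.I * (Complex.ofRealCLM p.2.1 + Complex.I * Complex.ofRealCLM p.2.2) := by
    fun_prop
  simp only [Tensor2.complexForm_apply]
  exact hcombine.contMDiff.contMDiffAt.comp x
    (((t.contMDiffAt_form hA.1 hB.1).prodMk_space (t.contMDiffAt_form hA.1 hB.2)).prodMk_space
      ((t.contMDiffAt_form hA.2 hB.1).prodMk_space (t.contMDiffAt_form hA.2 hB.2)))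

theorem exists_localFrame (x₀ : M) : ∃ e : Fin n → Π x : M, TangentSpace (𝓡 n) x,
    ∀ᶠ x in 𝓝 x₀, (∀ i, RealSmoothAt (e i) x) ∧
      ∃ b : Basis (Fin n) ℝ (TangentSpace (𝓡 n) x), ⇑b = fun i ↦ e i x := by
  let t := trivializationAt (EuclideanSpace ℝ (Fin n)) (TangentSpace (𝓡 n) : M → Type _) x₀
  let b := (EuclideanSpace.basisFun (Fin n) ℝ).toBasis
  refine ⟨t.localFrame b, ?_⟩
  filter_upwards [t.open_baseSet.mem_nhds (FiberBundle.mem_baseSet_trivializationAt' x₀)]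
    with x hx
  exact ⟨fun i ↦ (t.contMDiffOn_localFrame_baseSet (I := 𝓡 n) ∞ b i).contMDiffAt
    (t.open_baseSet.mem_nhds hx), t.basisAt b hx,
    funext fun i ↦ (t.localFrame_apply_of_mem_baseSet b hx).symm⟩

end SmoothFields

section FrameComponents

variable {n : ℕ} {M : Type*} [TopologicalSpace M] [ChartedSpace (EuclideanSpace ℝ (Fin n)) M]
  {e : Fin n → Π x : M, TangentSpace (𝓡 n) x} {x : M}

/-- The map sending components with respect to a real local frame `e` to a complex tangent
vector. -/
def frameMap (e : Fin n → Π x : M, TangentSpace (𝓡 n) x) (x : M) :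
    (Fin n → ℂ) →ₗ[ℂ] CTangent n x :=
  Fintype.linearCombination ℂ fun i ↦ 1 ⊗ₜ e i x

theorem bijective_frameMap {b : Basis (Fin n) ℝ (TangentSpace (𝓡 n) x)}
    (hb : ⇑b = fun i ↦ e i x) : Function.Bijective (frameMap e x) := by
  have hframe : frameMap e x = (Algebra.TensorProduct.basis ℂ b).equivFun.symm := by
    ext
    simp [frameMap, hb]
  rw [hframe]
  exact LinearEquiv.bijective _

variable [IsManifold (𝓡 n) ∞ M]

theorem smoothFieldAt_frameMap (he : ∀ i, RealSmoothAt (e i) x) {v : M → Fin n → ℂ}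
    (hv : ContMDiffAt (𝓡 n) 𝓘(ℝ, Fin n → ℂ) ∞ v x) :
    SmoothFieldAt (fun y ↦ frameMap e y (v y)) x := by
  have hre (i : Fin n) : ContMDiffAt (𝓡 n) 𝓘(ℝ, ℝ) ∞ (fun y ↦ (v y i).re) x :=
    Complex.reCLM.contDiff.contMDiff.contMDiffAt.comp x (contMDiffAt_pi_space.1 hv i)
  have him (i : Fin n) : ContMDiffAt (𝓡 n) 𝓘(ℝ, ℝ) ∞ (fun y ↦ (v y i).im) x :=
    Complex.imCLM.contDiff.contMDiff.contMDiffAt.comp x (contMDiffAt_pi_space.1 hv i)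
  constructor
  · have hsum (y : M) : rePart (frameMap e y (v y)) = ∑ i, (v y i).re • e i y := by
      simp [frameMap, Fintype.linearCombination_apply, rePart_tmul, TensorProduct.smul_tmul']
    simp only [hsum]
    exact .sum_section fun i _ ↦ (hre i).smul_section (he i)
  · have hsum (y : M) : imPart (frameMap e y (v y)) = ∑ i, (v y i).im • e i y := by
      simp [frameMap, Fintype.linearCombination_apply, imPart_tmul, TensorProduct.smul_tmul']
    simp only [hsum]
    exact .sum_section fun i _ ↦ (him i).smul_section (he i)

/-- The bilinear form `t` at `x` in the components of the frame `e`, as the operator sending the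
components of `z` to the values `t (z, e k)`. -/
def Tensor2.frameOperator (t : Tensor2 n M) (e : Fin n → Π x : M, TangentSpace (𝓡 n) x) (x : M) :
    (Fin n → ℂ) →L[ℂ] (Fin n → ℂ) :=
  ∑ i, ∑ k, t.form x (e i x) (e k x) •
    (ContinuousLinearMap.proj (R := ℂ) (φ := fun _ : Fin n ↦ ℂ) i).smulRight (Pi.single k (1 : ℂ))

theorem Tensor2.frameOperator_apply (t : Tensor2 n M) (e : Fin n → Π x : M, TangentSpace (𝓡 n) x)
    (x : M) (v : Fin n → ℂ) (k : Fin n) :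
    t.frameOperator e x v k = t.complexForm x (frameMap e x v) (1 ⊗ₜ e k x) := by
  have hform (i : Fin n) : t.complexForm x (1 ⊗ₜ e i x) (1 ⊗ₜ e k x) =
      t.form x (e i x) (e k x) := by simp [Tensor2.complexForm]
  simp [frameOperator, frameMap, Fintype.linearCombination_apply, hform, mul_comm,
    Pi.single_apply]

theorem Tensor2.contMDiffAt_frameOperator (t : Tensor2 n M) (he : ∀ i, RealSmoothAt (e i) x) :
    ContMDiffAt (𝓡 n) 𝓘(ℝ, (Fin n → ℂ) →L[ℂ] (Fin n → ℂ)) ∞ (t.frameOperator e) x :=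
  contMDiffAt_finsetSum fun i _ ↦ contMDiffAt_finsetSum fun k _ ↦
    (t.contMDiffAt_form (he i) (he k)).smul contMDiffAt_const

theorem complexRaise_frameMap_iff {g : PseudoRiemannianMetric n M} {φ : TwoForm n M}
    {b : Basis (Fin n) ℝ (TangentSpace (𝓡 n) x)} (hb : ⇑b = fun i ↦ e i x) {v v' : Fin n → ℂ}
    {c c' : ℂ} :
    complexRaise g φ x (frameMap e x v') - c • frameMap e x v' = c' • frameMap e x v ↔
      φ.frameOperator e x v' - c • g.frameOperator e x v' = c' • g.frameOperator e x v := by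
  have hinj : Function.Injective (g.complexForm x) :=
    LinearMap.ker_eq_bot.1 (LinearMap.separatingLeft_iff_ker_eq_bot.1
      (g.separatingLeft_complexForm x))
  refine ⟨fun h ↦ funext fun k ↦ ?_, fun h ↦ hinj <|
    (Algebra.TensorProduct.basis ℂ b).ext fun k ↦ ?_⟩
  · simpa [Tensor2.frameOperator_apply, complexForm_complexRaise] using
      congr(g.complexForm x $h (1 ⊗ₜ e k x))
  · simpa [Tensor2.frameOperator_apply, complexForm_complexRaise, hb] using congrFun h k

end FrameComponents

section EigenvectorFields

variable {n : ℕ} {M : Type*} [TopologicalSpace M] [ChartedSpace (EuclideanSpace ℝ (Fin n)) M]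
  [IsManifold (𝓡 n) ∞ M] {g : PseudoRiemannianMetric n M} {φ : TwoForm n M} {x₀ : M}

theorem exists_eigenfield_frameOperator {e : Fin n → Π x : M, TangentSpace (𝓡 n) x}
    (he : ∀ᶠ x in 𝓝 x₀, ∀ i, RealSmoothAt (e i) x) {c : ℂ} {v : Fin n → ℂ} (hv : v ≠ 0)
    (h : φ.frameOperator e x₀ v = c • g.frameOperator e x₀ v)
    (hsimple : ∀ (v' : Fin n → ℂ) (c' : ℂ),
      φ.frameOperator e x₀ v' - c • g.frameOperator e x₀ v' = c' • g.frameOperator e x₀ v →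
        c' = 0 ∧ v' ∈ Submodule.span ℂ {v}) :
    ∃ f : M → ℂ × (Fin n → ℂ), f x₀ = (c, v) ∧
      ∀ᶠ x in 𝓝 x₀, ContMDiffAt (𝓡 n) 𝓘(ℝ, ℂ × (Fin n → ℂ)) ∞ f x ∧
        φ.frameOperator e x (f x).2 = (f x).1 • g.frameOperator e x (f x).2 := by
  obtain ⟨F, hF₀, hF, hFeq⟩ := exists_contDiffAt_eigenpair rfl hv h hsimple
  let p (x : M) := (φ.toTensor2.frameOperator e x, g.toTensor2.frameOperator e x)
  have hp {x : M} (hx : ∀ i, RealSmoothAt (e i) x) : ContMDiffAt (𝓡 n)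
      𝓘(ℝ, ((Fin n → ℂ) →L[ℂ] (Fin n → ℂ)) × ((Fin n → ℂ) →L[ℂ] (Fin n → ℂ))) ∞ p x :=
    (φ.contMDiffAt_frameOperator hx).prodMk_space (g.contMDiffAt_frameOperator hx)
  have hp₀ : ContinuousAt p x₀ := (hp he.self_of_nhds).continuousAt
  refine ⟨F ∘ p, hF₀, ?_⟩
  filter_upwards [he, hp₀.eventually (hF.eventually (by simp)), hp₀.eventually hFeq]
    with x hex hFx hFeqx
  exact ⟨((hFx.restrict_scalars ℝ).of_le le_top).contMDiffAt.comp x (hp hex), hFeqx⟩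

theorem exists_eigenfield {c : ℂ} {z : CTangent n x₀} (hz : z ≠ 0)
    (h : complexRaise g φ x₀ z = c • z)
    (hsimple : ∀ (y : CTangent n x₀) (c' : ℂ), complexRaise g φ x₀ y - c • y = c' • z →
      c' = 0 ∧ y ∈ Submodule.span ℂ {z}) :
    ∃ (C : M → ℂ) (Z : Π x : M, CTangent n x), C x₀ = c ∧ Z x₀ = z ∧
      ∀ᶠ x in 𝓝 x₀, ContMDiffAt (𝓡 n) 𝓘(ℝ, ℂ) ∞ C x ∧ SmoothFieldAt Z x ∧
        complexRaise g φ x (Z x) = C x • Z x := by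
  obtain ⟨e, he⟩ := exists_localFrame (n := n) x₀
  have hraise {x : M} {b : Basis (Fin n) ℝ (TangentSpace (𝓡 n) x)} (hb : ⇑b = fun i ↦ e i x)
      (c : ℂ) (v : Fin n → ℂ) : complexRaise g φ x (frameMap e x v) = c • frameMap e x v ↔
        φ.frameOperator e x v = c • g.frameOperator e x v := by
    simpa [sub_eq_zero] using complexRaise_frameMap_iff hb (v := 0) (v' := v) (c := c) (c' := 0)
  obtain ⟨-, b, hb⟩ := he.self_of_nhds
  obtain ⟨v, rfl⟩ := (bijective_frameMap hb).surjective z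
  obtain ⟨f, hf₀, hf⟩ := exists_eigenfield_frameOperator (he.mono fun x hx ↦ hx.1)
    (fun hv ↦ hz (by simp [hv])) ((hraise hb c v).1 h) fun v' c' hv' ↦ by
      refine (hsimple _ _ ((complexRaise_frameMap_iff hb).2 hv')).imp_right fun hmem ↦ ?_
      rwa [← Set.image_singleton, ← Submodule.map_span, ← SetLike.mem_coe, Submodule.map_coe,
        (bijective_frameMap hb).injective.mem_set_image] at hmem
  refine ⟨fun x ↦ (f x).1, fun x ↦ frameMap e x (f x).2, by simp [hf₀], by simp [hf₀], ?_⟩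
  filter_upwards [he, hf] with x ⟨hex, b, hb⟩ ⟨hfx, hfeq⟩
  exact ⟨contDiff_fst.contMDiff.contMDiffAt.comp x hfx,
    smoothFieldAt_frameMap hex (contDiff_snd.contMDiff.contMDiffAt.comp x hfx),
    (hraise hb _ _).2 hfeq⟩

end EigenvectorFields

section Existence

variable {m : ℕ} {M : Type*} [TopologicalSpace M]
  [ChartedSpace (EuclideanSpace ℝ (Fin (2 * m + 1))) M] [IsManifold (𝓡 (2 * m + 1)) ∞ M]
  {g : PseudoRiemannianMetric (2 * m + 1) M} {φ : TwoForm (2 * m + 1) M} {x x₀ : M}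

theorem IsGenericAt.hasEigenvalue_zero (hgen : IsGenericAt m g φ x) :
    (complexRaise g φ x).HasEigenvalue 0 := by
  obtain ⟨⟨k, hk⟩, hk0⟩ := Module.finrank_pos_iff_exists_ne_zero.1
    (by rw [hgen.2]; exact one_pos : 0 < finrank ℝ (LinearMap.ker (raise g φ x)))
  refine Module.End.hasEigenvalue_of_hasEigenvector (x := 1 ⊗ₜ k)
    (Module.End.hasEigenvector_iff.2 ⟨?_, fun h0 ↦ hk0 ?_⟩)
  · rw [Module.End.mem_eigenspace_iff, complexRaise_one_tmul, LinearMap.mem_ker.1 hk]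
    simp
  · simpa [rePart_tmul] using congrArg rePart h0

theorem IsGenericAt.exists_eigenvalues (hgen : IsGenericAt m g φ x) :
    ∃ lam : Fin m → ℂ, Function.Injective (normalFamily 0 lam (-lam)) ∧
      ∀ a, (complexRaise g φ x).HasEigenvalue (normalFamily 0 lam (-lam) a) := by
  let S := {c : ℂ // c ≠ 0 ∧ (complexRaise g φ x).HasEigenvalue c}
  have : Finite S := ((complexRaise g φ x).finite_hasEigenvalue.subset fun c hc ↦ hc.2).to_subtype
  have hneg {c : ℂ} (hc : (complexRaise g φ x).HasEigenvalue c) :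
      (complexRaise g φ x).HasEigenvalue (-c) :=
    hasEigenvalue_neg_of_isSkewAdjoint (g.separatingLeft_complexForm x)
      (isSkewAdjoint_complexRaise g φ) hc
  let neg (c : S) : S := ⟨-c, neg_ne_zero.2 c.2.1, hneg c.2.2⟩
  obtain ⟨e, he⟩ := exists_equiv_sum_of_involutive (α := S) (σ := neg) hgen.1
    (fun c ↦ Subtype.ext (neg_neg _)) fun c hc ↦ c.2.1 (neg_eq_self.1 congr(($hc).1))
  have hlam (a : Fin m ⊕ Fin m) :
      normalFamily 0 (fun i ↦ (e (.inl i) : ℂ)) (-fun i ↦ (e (.inl i) : ℂ)) (some a) = e a := by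
    rcases a with i | i
    · rfl
    · exact congr(($(he i)).1).symm
  refine ⟨fun i ↦ e (.inl i), ?_, ?_⟩
  · rintro (_ | a) (_ | b) hab
    · rfl
    · exact absurd (hab.trans (hlam b)).symm (e b).2.1
    · exact absurd ((hlam a).symm.trans hab) (e a).2.1
    · rw [hlam, hlam] at hab
      exact congrArg some (e.injective (Subtype.ext hab))
  · rintro (_ | a)
    · exact hgen.hasEigenvalue_zero
    · rw [hlam]
      exact (e a).2.2

theorem IsGenericAt.exists_eigenbasis (hgen : IsGenericAt m g φ x) :
    ∃ (c : NormalIndex m → ℂ) (b : Basis (NormalIndex m) ℂ (CTangent (2 * m + 1) x)),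
      Function.Injective c ∧ (∀ a, c a.swap = -c a) ∧
        ∀ a, complexRaise g φ x (b a) = c a • b a := by
  obtain ⟨lam, hinj, hlam⟩ := hgen.exists_eigenvalues
  choose z hz using fun a ↦ (hlam a).exists_hasEigenvector
  refine ⟨_, basisOfLinearIndependentOfCardEqFinrank
    (Module.End.eigenvectors_linearIndependent' _ _ hinj z hz)
    ((card_normalIndex m).trans (finrank_cTangent x).symm), hinj, ?_, fun a ↦ ?_⟩
  · rintro (_ | _ | _) <;> simp [normalFamily, NormalIndex.swap]
  · simpa using (hz a).apply_eq_smul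

theorem isNormalBasisAt_of_eigenvectors {c : NormalIndex m → ℂ}
    {z : NormalIndex m → CTangent (2 * m + 1) x} (hz : ∀ a, complexRaise g φ x (z a) = c a • z a)
    (hc : ∀ a b, b ≠ a.swap → c a + c b ≠ 0)
    (hg : ∀ a, g.complexForm x (z a) (z a.swap) = 1) :
    IsNormalBasisAt g φ x (fun i ↦ c (some (.inl i))) (z none) (fun i ↦ z (some (.inl i)))
      fun i ↦ z (some (.inr i)) := by
  have hadd (a b) : (c a + c b) * g.complexForm x (z a) (z b) = 0 :=
    add_mul_apply_eq_zero_of_isSkewAdjoint (isSkewAdjoint_complexRaise g φ) (hz a) (hz b)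
  have hswap (a) : c a.swap = -c a := by
    have := hadd a a.swap
    rw [hg, mul_one] at this
    exact eq_neg_of_add_eq_zero_right this
  have hzfam :
      normalFamily (z none) (fun i ↦ z (some (.inl i))) (fun i ↦ z (some (.inr i))) = z := by
    ext (_ | _ | _) <;> rfl
  have hcfam (a) : normalFamily 0 (fun i ↦ c (some (.inl i))) (-fun i ↦ c (some (.inl i))) a =
      c a := by
    rcases a with _ | i | i
    · exact (self_eq_neg.1 (hswap none)).symm
    · rfl
    · exact (hswap (some (.inl i))).symm
  refine isNormalBasisAt_iff.2 fun a b ↦ ?_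
  rw [hzfam, hcfam, ← complexForm_complexRaise g φ, hz, map_smul, LinearMap.smul_apply, smul_eq_mul]
  split_ifs with hab
  · rw [hab, hg, mul_one]
    exact ⟨rfl, rfl⟩
  · have hzero := (mul_eq_zero.1 (hadd a b)).resolve_left (hc a b hab)
    rw [hzero, mul_zero]
    exact ⟨rfl, rfl⟩

theorem exists_normalizing_factors {n : ℕ} {N : Type*} [TopologicalSpace N]
    [ChartedSpace (EuclideanSpace ℝ (Fin n)) N] {x₀ : N} {q : NormalIndex m → N → ℂ}
    (hq : ∀ᶠ x in 𝓝 x₀, ∀ a, ContMDiffAt (𝓡 n) 𝓘(ℝ, ℂ) ∞ (q a) x)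
    (hswap : ∀ a, q a.swap = q a) (hq₀ : ∀ a, q a x₀ ≠ 0) :
    ∃ r : NormalIndex m → N → ℂ, ∀ᶠ x in 𝓝 x₀, ∀ a,
      ContMDiffAt (𝓡 n) 𝓘(ℝ, ℂ) ∞ (r a) x ∧ r a x * r a.swap x * q a x = 1 := by
  obtain ⟨s, hs, hsq⟩ := exists_analyticAt_sq_eq (hq₀ none)
  have hcont (a) : ContinuousAt (q a) x₀ := (hq.self_of_nhds a).continuousAt
  refine ⟨normalFamily (fun x ↦ (s (q none x))⁻¹) (fun _ _ ↦ 1)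
    fun i x ↦ (q (some (.inl i)) x)⁻¹, ?_⟩
  filter_upwards [hq, eventually_all.2 fun a ↦ (hcont a).eventually_ne (hq₀ a),
    (hcont none).eventually hs.eventually_analyticAt] with x hqx hx hsx
  have hs0 : s (q none x) ≠ 0 := fun h0 ↦ hx none (by rw [← hsq (q none x), h0, sq, zero_mul])
  rintro (_ | i | i)
  · have hsmooth : ContDiffAt ℝ ∞ (fun z ↦ (s z)⁻¹) (q none x) :=
      (hsx.contDiffAt.inv hs0).restrict_scalars ℝ
    refine ⟨hsmooth.contMDiffAt.comp x (hqx none), ?_⟩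
    calc (s (q none x))⁻¹ * (s (q none x))⁻¹ * q none x
        = (s (q none x))⁻¹ ^ 2 * s (q none x) ^ 2 := by rw [hsq, sq]
      _ = 1 := by rw [← mul_pow, inv_mul_cancel₀ hs0, one_pow]
  · exact ⟨contMDiffAt_const, by
      simpa [normalFamily, NormalIndex.swap] using inv_mul_cancel₀ (hx (some (.inl i)))⟩
  · refine ⟨(contDiffAt_inv ℝ (hx _)).contMDiffAt.comp x (hqx (some (.inl i))), ?_⟩
    rw [show q (some (.inr i)) = q (some (.inl i)) from hswap (some (.inl i))]
    simpa [normalFamily, NormalIndex.swap] using inv_mul_cancel₀ (hx (some (.inl i)))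

theorem IsGenericAt.exists_eigenframe (hgen : IsGenericAt m g φ x₀) :
    ∃ (C : NormalIndex m → M → ℂ) (Z : NormalIndex m → Π x : M, CTangent (2 * m + 1) x),
      (∀ a b, b ≠ a.swap → C a x₀ + C b x₀ ≠ 0) ∧
      (∀ a, g.complexForm x₀ (Z a x₀) (Z a.swap x₀) ≠ 0) ∧
      ∀ᶠ x in 𝓝 x₀, ∀ a, ContMDiffAt (𝓡 (2 * m + 1)) 𝓘(ℝ, ℂ) ∞ (C a) x ∧
        SmoothFieldAt (Z a) x ∧ complexRaise g φ x (Z a x) = C a x • Z a x := by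
  obtain ⟨c, b, hc, hswap, hb⟩ := hgen.exists_eigenbasis
  choose C Z hC hZ hCZ using fun a ↦ exists_eigenfield (b.ne_zero a) (hb a)
    fun _ _ ↦ eq_zero_and_mem_span_of_sub_smul_eq hb hc
  refine ⟨C, Z, fun a a' h h0 ↦ h (hc ?_), fun a ↦ ?_, eventually_all.2 hCZ⟩
  · rw [hC, hC] at h0
    rw [hswap, eq_neg_of_add_eq_zero_right h0]
  · rw [hZ, hZ]
    exact apply_ne_zero_of_isSkewAdjoint (g.separatingLeft_complexForm x₀)
      (isSkewAdjoint_complexRaise g φ) hb hc hswap a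

theorem IsGenericAt.exists_isNormalFrameOn (hgen : IsGenericAt m g φ x₀) :
    ∃ U : Set M, IsOpen U ∧ x₀ ∈ U ∧
      ∃ (lam : Fin m → M → ℂ) (V0 : Π x : M, CTangent (2 * m + 1) x)
        (V W : Fin m → Π x : M, CTangent (2 * m + 1) x), IsNormalFrameOn g φ U lam V0 V W := by
  obtain ⟨C, Z, hne, hq₀, hCZ⟩ := hgen.exists_eigenframe
  obtain ⟨r, hr⟩ := exists_normalizing_factors
    (q := fun a x ↦ g.complexForm x (Z a x) (Z a.swap x))
    (hCZ.mono fun x hx a ↦ g.contMDiffAt_complexForm (hx a).2.1 (hx a.swap).2.1)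
    (fun a ↦ funext fun x ↦ by rw [NormalIndex.swap_involutive a, g.complexForm_comm]) hq₀
  have hCne : ∀ᶠ x in 𝓝 x₀, ∀ a b, b ≠ a.swap → C a x + C b x ≠ 0 :=
    eventually_all.2 fun a ↦ eventually_all.2 fun b ↦ eventually_imp_distrib_left.2 fun hab ↦
      ((hCZ.self_of_nhds a).1.continuousAt.add
        (hCZ.self_of_nhds b).1.continuousAt).eventually_ne (hne a b hab)
  obtain ⟨U, hUgood, hU, hxU⟩ := mem_nhds_iff.1 (hCZ.and (hr.and hCne))
  have hsmooth (a) : SmoothFieldOn (fun x ↦ r a x • Z a x) U :=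
    smoothFieldOn_of_forall_smoothFieldAt fun x hx ↦
      .smul ((hUgood hx).2.1 a).1 ((hUgood hx).1 a).2.1
  refine ⟨U, hU, hxU, fun i ↦ C (some (.inl i)), fun x ↦ r none x • Z none x,
    fun i x ↦ r (some (.inl i)) x • Z (some (.inl i)) x,
    fun i x ↦ r (some (.inr i)) x • Z (some (.inr i)) x,
    ⟨hsmooth none, fun i ↦ hsmooth _, fun i ↦ hsmooth _, fun x hx ↦ ?_⟩⟩
  obtain ⟨hCZx, hrx, hCnex⟩ := hUgood hx
  refine isNormalBasisAt_of_eigenvectors (c := fun a ↦ C a x) (z := fun a ↦ r a x • Z a x)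
    (fun a ↦ by rw [map_smul, (hCZx a).2.2, smul_comm]) hCnex fun a ↦ ?_
  simpa [mul_assoc, mul_left_comm] using (hrx a).2

end Existence

end CKY

end

theorem mainTheorem2_general {m : ℕ} {M : Type*} [TopologicalSpace M]
    [ChartedSpace (EuclideanSpace ℝ (Fin (2 * m + 1))) M]
    [IsManifold (𝓡 (2 * m + 1)) ∞ M]
    (g : CKY.PseudoRiemannianMetric (2 * m + 1) M) (φ : CKY.TwoForm (2 * m + 1) M) :
    (∀ x₀ : M, CKY.IsGenericAt m g φ x₀ → ∃ U : Set M, IsOpen U ∧ x₀ ∈ U ∧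
      ∃ (lam : Fin m → M → ℂ) (V0 : Π x : M, CKY.CTangent (2 * m + 1) x)
        (V W : Fin m → Π x : M, CKY.CTangent (2 * m + 1) x),
        CKY.IsNormalFrameOn g φ U lam V0 V W) ∧
    ∀ (U : Set M) (lam : Fin m → M → ℂ) (V0 : Π x : M, CKY.CTangent (2 * m + 1) x)
      (V W : Fin m → Π x : M, CKY.CTangent (2 * m + 1) x),
      CKY.IsConformalKillingYano g φ → IsOpen U → (∀ x ∈ U, CKY.IsGenericAt m g φ x) →
      (∀ x ∈ U, CKY.TauConditionAt m g φ x) → CKY.IsNormalFrameOn g φ U lam V0 V W →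
      (∀ x ∈ U, Function.Injective fun s : Fin m → Bool ↦ CKY.choiceDist V W s x) ∧
      ∀ s : Fin m → Bool,
        (∀ x ∈ U, CKY.IsMaximalIsotropic m g φ x (CKY.choiceDist V W s x)) ∧
        CKY.IsSubbundleOn m (CKY.choiceDist V W s) U ∧
        CKY.IsIntegrableOn (CKY.choiceDist V W s) U ∧
        (g.IsRiemannian → CKY.IsCRStructureOn m (CKY.choiceDist V W s) U) ∧
        ((∀ x ∈ U, CKY.choiceDist V W s x ⊓ CKY.conjSubspace (CKY.choiceDist V W s x) = ⊥) →
          CKY.IsCRStructureOn m (CKY.choiceDist V W s) U) ∧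
        CKY.IsSubbundleOn (m + 1) (CKY.choiceDistAdjoin V0 V W s) U ∧
        CKY.IsIntegrableOn (CKY.choiceDistAdjoin V0 V W s) U := by
  refine ⟨fun _ hgen ↦ hgen.exists_isNormalFrameOn, fun U lam V0 V W hφ hU hgen hτ h ↦
    ⟨fun x hx ↦ (h.normal x hx).injective_span_choice, fun s ↦ ?_⟩⟩
  have hiso (x) (hx : x ∈ U) : CKY.IsMaximalIsotropic m g φ x (CKY.choiceDist V W s x) :=
    ((h.flip s).normal x hx).isMaximalIsotropic (hgen x hx)
  have hrank : CKY.IsSubbundleOn m (CKY.choiceDist V W s) U := (h.flip s).isSubbundleOn_span hU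
  have hint : CKY.IsIntegrableOn (CKY.choiceDist V W s) U :=
    (h.flip s).isIntegrableOn_span hφ hU hgen hτ
  refine ⟨hiso, hrank, hint, fun hg ↦ ⟨hrank, fun x hx ↦ ?_, hint⟩, fun hCR ↦ ⟨hrank, hCR, hint⟩,
    (h.flip s).isSubbundleOn_span_sup hU, (h.flip s).isIntegrableOn_span_sup hφ hU hgen hτ⟩
  exact CKY.inf_conjSubspace_eq_bot hg fun z hz w hw ↦
    (CKY.gC_eq_complexForm g x z w).symm.trans ((hiso x hx).2.1 z hz w hw)

theorem mainTheorem2 {m : ℕ} (hm : 1 ≤ m) {M : Type*} [TopologicalSpace M] [T2Space M]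
    [SecondCountableTopology M] [ChartedSpace (EuclideanSpace ℝ (Fin (2 * m + 1))) M]
    [IsManifold (𝓡 (2 * m + 1)) ∞ M]
    (g : CKY.PseudoRiemannianMetric (2 * m + 1) M) (φ : CKY.TwoForm (2 * m + 1) M)
    (hφ : CKY.IsConformalKillingYano g φ)
    (hgen : ∀ x, CKY.IsGenericAt m g φ x)
    (hτ : ∀ x, CKY.TauConditionAt m g φ x) :
    (∀ x₀ : M, ∃ U : Set M, IsOpen U ∧ x₀ ∈ U ∧
      ∃ (lam : Fin m → M → ℂ) (V0 : Π x : M, CKY.CTangent (2 * m + 1) x)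
        (V W : Fin m → Π x : M, CKY.CTangent (2 * m + 1) x),
        CKY.IsNormalFrameOn g φ U lam V0 V W) ∧
    ∀ (U : Set M) (lam : Fin m → M → ℂ) (V0 : Π x : M, CKY.CTangent (2 * m + 1) x)
      (V W : Fin m → Π x : M, CKY.CTangent (2 * m + 1) x),
      IsOpen U → CKY.IsNormalFrameOn g φ U lam V0 V W →
      (∀ x ∈ U, Function.Injective fun s : Fin m → Bool ↦ CKY.choiceDist V W s x) ∧
      ∀ s : Fin m → Bool,
        (∀ x ∈ U, CKY.IsMaximalIsotropic m g φ x (CKY.choiceDist V W s x)) ∧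
        CKY.IsSubbundleOn m (CKY.choiceDist V W s) U ∧
        CKY.IsIntegrableOn (CKY.choiceDist V W s) U ∧
        (g.IsRiemannian → CKY.IsCRStructureOn m (CKY.choiceDist V W s) U) ∧
        ((∀ x ∈ U, CKY.choiceDist V W s x ⊓ CKY.conjSubspace (CKY.choiceDist V W s x) = ⊥) →
          CKY.IsCRStructureOn m (CKY.choiceDist V W s) U) ∧
        CKY.IsSubbundleOn (m + 1) (CKY.choiceDistAdjoin V0 V W s) U ∧
        CKY.IsIntegrableOn (CKY.choiceDistAdjoin V0 V W s) U :=
  (mainTheorem2_general g φ).imp (fun h x₀ ↦ h x₀ (hgen x₀)) fun h U lam V0 V W hU ↦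
    h U lam V0 V W hφ hU (fun x _ ↦ hgen x) fun x _ ↦ hτ x
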